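/- Let $p$ be a prime, $k$ a field of characteristic $p$, and $K/k$ a purely inseparable field extension. Definitions. For a field extension $E/F$ in characteristic $p$, an $r$-basis of $E/F$ is a subset $B\subseteq E$ with $E=F(E^p)(B)$ and $x\notin F(E^p)(B\setminus\{x\})$ for all $x\in B$; all $r$-bases of $E/F$ have the same cardinality. For $n\ge 0$ put $F_n=F^{p^{-n}}\cap E=\{x\in E : x^{p^n}\in F\}$. The irrationality degree $di(E/F)$ is $\sup_{n\ge 1}|B_n|$, where $B_n$ is an $r$-basis of $F_n/F$, and $E/F$ is $q$-finite if $di(E/F)$ is finite. $E/F$ is relatively perfect if $F(E^p)=E$, and $rp(E/F)$ denotes the largest intermediate field of $E/F$ that is relatively perfect over $F$. $E/F$ is modular if for every $n\ge 0$ the fields $E^{p^n}$ and $F$ are linearly disjoint over $E^{p^n}\cap F$. If $E/F$ is finite and purely inseparable, a canonically ordered $r$-basis is an $r$-basis $\{a_1,\dots,a_n\}$ such that for every $j$, with $L=F(a_1,\dots,a_{j-1})$, the least $m$ with $a_j^{p^m}\in L$ equals the least $m$ with $E^{p^m}\subseteq L$. For $s\ge 1$, the $s$-th exponent $o_s(E/F)$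 is this least $m$ for $j=s$ if $s\le n$, and $0$ if $s>n$; it does not depend on the choice of the canonically ordered $r$-basis. Assume that $K/k$ is $q$-finite. Put $k_j=k^{p^{-j}}\cap K$ and $U_s^j(K/k)=j-o_s(k_j/k)$ for $s\ge 1$, $j\ge 0$, and let $Ilqm(K/k)$ be the least integer $i\ge 1$ such that the sequence $(U_i^j(K/k))_{j\in\mathbb N}$ is unbounded. Theorem. The irrationality degree $t=di(rp(K/k)/k)$ is finite, and the following are equivalent: 1. there is an intermediate field $k\subseteq L\subseteq K$, finite over $k$, such that $K/L$ is modular; 2. for every $s\in\{1,\dots,t\}$ the sequence $(U_s^j(K/k))_{j\in\mathbb N}$ is bounded; 3. $Ilqm(K/k)=t+1$. -/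

import Mathlib

namespace PurelyInsep

universe u v

section General

variable (p : ℕ) (F : Type u) (E : Type v) [Field F] [Field E] [Algebra F E]

/-- The intermediate field `F(E^p)`. -/
def powField : IntermediateField F E :=
  IntermediateField.adjoin F (Set.range fun x : E => x ^ p)

/-- `G` is a minimal `r`-generator of `E/F`: `E = F(G)` and no `x ∈ G` lies in `F(G \ {x})`. -/
def IsMinimalRGenerator (G : Set E) : Prop :=
  IntermediateField.adjoin F G = ⊤ ∧ ∀ x ∈ G, x ∉ IntermediateField.adjoin F (G \ {x})

/-- `B` is an `r`-basis of `E/F`: a minimal `r`-generator of `E/F(E^p)`. -/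
def IsRBasis (B : Set E) : Prop :=
  IsMinimalRGenerator (powField p F E) E B

/-- The cardinality of an `r`-basis of `E/F` (they all have the same one). -/
noncomputable def rCard : Cardinal.{v} :=
  sInf {c | ∃ B : Set E, IsRBasis p F E B ∧ c = Cardinal.mk B}

/-- `E/F` is relatively perfect: `F(E^p) = E`. -/
def IsRelativelyPerfect : Prop := powField p F E = ⊤

/-- The relatively perfect closure `rp(E/F)`: the largest relatively perfect subextension,
that is, the compositum of all of them. -/
noncomputable def rp : IntermediateField F E :=
  sSup {L : IntermediateField F E | IsRelativelyPerfect p F L}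

variable {F E} in
/-- `o(x/L)`: the least `m` with `x^(p^m) ∈ L`. -/
noncomputable def order (L : IntermediateField F E) (x : E) : ℕ :=
  sInf {m : ℕ | x ^ p ^ m ∈ L}

variable {F E} in
/-- `o₁(E/L)`: the least `m` with `E^(p^m) ⊆ L`. -/
noncomputable def height (L : IntermediateField F E) : ℕ :=
  sInf {m : ℕ | ∀ x : E, x ^ p ^ m ∈ L}

variable {F E} in
/-- `F(a_i : i < j)`, the field generated by the terms of the family that precede `a_j`. -/
def before {n : ℕ} (a : Fin n → E) (j : Fin n) : IntermediateField F E :=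
  IntermediateField.adjoin F (a '' {i | i < j})

/-- `(a_1, …, a_n)` is a canonically ordered `r`-basis of `E/F`. -/
def IsCanonicalRBasis {n : ℕ} (a : Fin n → E) : Prop :=
  Function.Injective a ∧ IsRBasis p F E (Set.range a) ∧
    ∀ j : Fin n, order p (before (F := F) a j) (a j) = height p (before (F := F) a j)

/-- The `s`-th exponent `o_s(E/F)`, `s ≥ 1`, of a finite purely inseparable extension `E/F`:
for a canonically ordered `r`-basis `(a_1, …, a_n)` it is `o(a_s/F(a_1, …, a_{s-1}))` if
`s ≤ n` and `0` if `s > n`. It does not depend on the canonically ordered `r`-basis, so the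
infimum below is over one value. The element `a_s` is `a j` with `j + 1 = s`. -/
noncomputable def exponent (s : ℕ) : ℕ :=
  sInf {e : ℕ | ∃ (n : ℕ) (a : Fin n → E), IsCanonicalRBasis p F E a ∧
    ((∃ j : Fin n, (j : ℕ) + 1 = s ∧ e = order p (before (F := F) a j) (a j)) ∨
      (n < s ∧ e = 0))}

variable {E} in
/-- Two subfields `A` and `B` of `E` are linearly disjoint over `A ∩ B`. -/
def LinDisjointOverInf (A B : Subfield E) : Prop :=
  (Subfield.extendScalars (inf_le_left : A ⊓ B ≤ A)).LinearDisjoint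
    (Subfield.extendScalars (inf_le_right : A ⊓ B ≤ B))

end General

section CharP

variable (p : ℕ) [Fact p.Prime] (F : Type u) (E : Type v) [Field F] [Field E] [Algebra F E]
  [CharP F p]

variable {F E} in
/-- `E/L` is modular: for all `n`, `E^(p^n)` and `L` are linearly disjoint over their
intersection. -/
def IsModularOver (L : IntermediateField F E) : Prop :=
  haveI : ExpChar E p := expChar_of_injective_algebraMap (algebraMap F E).injective p
  ∀ n : ℕ, LinDisjointOverInf (iterateFrobenius E p n).fieldRange L.toSubfield

/-- The intermediate field `F_n = F^(p^(-n)) ∩ E`, that is, the set of `x ∈ E` with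
`x^(p^n) ∈ F`. -/
def level (n : ℕ) : IntermediateField F E :=
  haveI : ExpChar E p := expChar_of_injective_algebraMap (algebraMap F E).injective p
  ((algebraMap F E).fieldRange.comap (iterateFrobenius E p n)).toIntermediateField
    fun x => ⟨x ^ p ^ n, by simp [iterateFrobenius_def]⟩

theorem mem_level {n : ℕ} {x : E} :
    x ∈ level p F E n ↔ x ^ p ^ n ∈ Set.range (algebraMap F E) := Iff.rfl

/-- The irrationality degree `di(E/F)`: the supremum over `n ≥ 1` of the cardinality of an
`r`-basis of `F_n/F`. -/
noncomputable def di : Cardinal.{v} :=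
  ⨆ n : ℕ, rCard p F (level p F E (n + 1))

/-- `E/F` is `q`-finite: its irrationality degree is finite. -/
def IsQFinite : Prop := di p F E < Cardinal.aleph0

/-- `U_s^j(E/F) = j - o_s(F_j/F)`. -/
noncomputable def U (s j : ℕ) : ℤ :=
  (j : ℤ) - (exponent p F (level p F E j) s : ℤ)

/-- The sequence `(U_s^j(E/F))_j` is bounded. -/
def BoundedU (s : ℕ) : Prop :=
  ∃ C : ℤ, ∀ j : ℕ, |U p F E s j| ≤ C

/-- `Ilqm(E/F)`: the first index `i ≥ 1` for which the sequence `(U_i^j(E/F))_j` is unbounded. -/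
noncomputable def Ilqm : ℕ :=
  sInf {i : ℕ | 1 ≤ i ∧ ¬ BoundedU p F E i}

end CharP

end PurelyInsep

namespace PurelyInsep

/-! ### Degrees between subfields and linear disjointness. -/

section Degree

variable {K : Type*} [Field K]

/-! Everything is moved into subfields of K. Let κ be the image of k and κ_j the field of elements
whose p^j-th power lies in κ. Finiteness of a degree is written `0 < relfinrank`, since an infinite
degree has value 0. The main tool is the step degree [L(A^(p^r)) : L(A^(p^(r+1)))], `powDegree`: for
A/L finite and purely inseparable it is p to the number of exponents greater than r
(`powDegree_eq_pow_card`, `lt_exponent_iff`). So U_s is bounded exactly when, for some C, the step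
degrees of κ_j/κ with r + C < j are all at least p^s (`boundedU_succ_iff`). Step degrees grow with
A, decrease with r and do not grow under base change.

By q-finiteness K = κ(K^p)κ_J for some J. Then P = rp(K/k) equals κ(K^(p^J)), and K = Pκ_J. Since
κ(κ_j^(p^J)) lies in P ∩ κ_j, at most t exponents of κ_j/κ exceed J, so U_(t+1) is unbounded. This
gives the equivalence of 2 and 3.

From 2 to 1 (`exists_linDisjointOverInf`): put N_j = log_p [κ_j : κ]. Past J it grows by at most t
per step, because K = Pκ_J, while large exponents force N_j ≥ t(j - C). Hence it grows by exactly t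
per step from some j₀ on. With L = κ_(j₀), this exact growth shows that degrees over K^(p^n) ∩ L do
not drop after adjoining L, which is linear disjointness.

From 1 to 2 (`hasLargeExponents_of_linDisjointOverInf`): passing from k to a finite L changes
degrees by at most the factor [L : k], too little to lower the irrationality degree of the
relatively perfect P (`exists_pow_le_powDegree_sup`). Modularity makes the step degrees of
L^(p^(-m)) ∩ K over L independent of m, so all those with r < m are at least p^t. A degree count
with L inside some κ_h transfers this to κ. -/

theorem relfinrank_sup_sup_le {A B : Subfield K} (h : A ≤ B) (hf : 0 < A.relfinrank B)
    (C : Subfield K) :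
    0 < (A ⊔ C).relfinrank (B ⊔ C) ∧ (A ⊔ C).relfinrank (B ⊔ C) ≤ A.relfinrank B := by
  let _ : Algebra A ↥(A ⊔ C) := (Subfield.inclusion (le_sup_left : A ≤ A ⊔ C)).toAlgebra
  have : IsScalarTower A ↥(A ⊔ C) K := IsScalarTower.of_algebraMap_eq fun _ => rfl
  rw [Subfield.relfinrank_eq_finrank_of_le h] at hf ⊢
  have : FiniteDimensional A (Subfield.extendScalars h) := FiniteDimensional.of_finrank_pos hf
  have key := IntermediateField.adjoin_rank_le_of_isAlgebraic_right
    (F := A) (↥(A ⊔ C)) (Subfield.extendScalars h) (K := K)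
  have hle : A ⊔ C ≤ B ⊔ C := sup_le_sup_right h C
  have heq : IntermediateField.adjoin (↥(A ⊔ C)) ((Subfield.extendScalars h : Set K)) =
      Subfield.extendScalars hle := by
    apply le_antisymm
    · rw [IntermediateField.adjoin_le_iff]
      intro x hx
      exact (le_sup_left : B ≤ B ⊔ C) hx
    · rw [Subfield.extendScalars_le_iff]
      apply sup_le
      · intro x hx
        exact IntermediateField.subset_adjoin _ _ hx
      · intro x hx
        exact (IntermediateField.adjoin (↥(A ⊔ C)) _).algebraMap_mem
          ⟨x, (le_sup_right : C ≤ A ⊔ C) hx⟩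
  rw [heq] at key
  rw [Subfield.relfinrank_eq_finrank_of_le hle]
  have hfin : Module.rank A (Subfield.extendScalars h) < Cardinal.aleph0 :=
    Module.rank_lt_aleph0 _ _
  have hfin2 := lt_of_le_of_lt key hfin
  refine ⟨?_, Cardinal.toNat_le_toNat key hfin⟩
  have : FiniteDimensional (↥(A ⊔ C)) (Subfield.extendScalars hle) :=
    Module.rank_lt_aleph0_iff.1 hfin2
  exact Module.finrank_pos

theorem relfinrank_sup_le (A B : Subfield K) {C : Subfield K} (hC : C ≤ A) (hCB : C ≤ B)
    (hf : 0 < C.relfinrank B) :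
    0 < A.relfinrank (A ⊔ B) ∧ A.relfinrank (A ⊔ B) ≤ C.relfinrank B := by
  have := relfinrank_sup_sup_le hCB hf A
  rwa [sup_eq_right.2 hC, sup_comm B A] at this

theorem relfinrank_pos_left {A B C : Subfield K} (h1 : A ≤ B) (h2 : B ≤ C)
    (h : 0 < A.relfinrank C) : 0 < A.relfinrank B := by
  rw [← Subfield.relfinrank_mul_relfinrank h1 h2] at h
  exact Nat.pos_of_mul_pos_right h

theorem relfinrank_pos_right {A B C : Subfield K} (h1 : A ≤ B) (h2 : B ≤ C)
    (h : 0 < A.relfinrank C) : 0 < B.relfinrank C := by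
  rw [← Subfield.relfinrank_mul_relfinrank h1 h2] at h
  exact Nat.pos_of_mul_pos_left h

theorem relfinrank_le_left {A B C : Subfield K} (h1 : A ≤ B) (h2 : B ≤ C)
    (h : 0 < A.relfinrank C) : A.relfinrank B ≤ A.relfinrank C := by
  rw [← Subfield.relfinrank_mul_relfinrank h1 h2] at h ⊢
  exact Nat.le_mul_of_pos_right _ (Nat.pos_of_mul_pos_left h)

theorem relfinrank_le_right {A B C : Subfield K} (h1 : A ≤ B) (h2 : B ≤ C)
    (h : 0 < A.relfinrank C) : B.relfinrank C ≤ A.relfinrank C := by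
  rw [← Subfield.relfinrank_mul_relfinrank h1 h2] at h ⊢
  exact Nat.le_mul_of_pos_left _ (Nat.pos_of_mul_pos_right h)

/-- An increasing sequence of extensions of bounded degree is stationary. -/
theorem exists_forall_le_of_relfinrank_le {C : Subfield K} {B : ℕ → Subfield K} (hB : Monotone B)
    (hC : ∀ n, C ≤ B n) {d : ℕ} (hf : ∀ n, 0 < C.relfinrank (B n))
    (hd : ∀ n, C.relfinrank (B n) ≤ d) : ∃ n, ∀ m, B m ≤ B n := by
  have hbd : BddAbove (Set.range fun n => C.relfinrank (B n)) := by
    refine ⟨d, ?_⟩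
    rintro _ ⟨n, rfl⟩
    exact hd n
  obtain ⟨n, hn⟩ := Nat.sSup_mem (Set.range_nonempty _) hbd
  refine ⟨n, fun m => (hB (le_max_right n m)).trans ?_⟩
  have h1 : B n ≤ B (max n m) := hB (le_max_left _ _)
  have h2 : C.relfinrank (B (max n m)) ≤ C.relfinrank (B n) :=
    (le_csSup hbd ⟨_, rfl⟩).trans hn.ge
  have h3 := Subfield.relfinrank_mul_relfinrank (hC n) h1
  have h4 := relfinrank_pos_right (hC n) h1 (hf _)
  rw [← Subfield.relfinrank_eq_one_iff]
  have := hf n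
  nlinarith

/-- A finite extension contained in the union of an increasing sequence of fields is contained
in one of them. -/
theorem exists_le_of_forall_mem {A C : Subfield K} (hCA : C ≤ A) (hf : 0 < C.relfinrank A)
    {B : ℕ → Subfield K} (hB : Monotone B) (hC : ∀ n, C ≤ B n)
    (hA : ∀ x ∈ A, ∃ n, x ∈ B n) : ∃ n, A ≤ B n := by
  obtain ⟨n, hn⟩ := exists_forall_le_of_relfinrank_le (B := fun n => A ⊓ B n)
    (fun m n h => inf_le_inf_left A (hB h)) (fun n => le_inf hCA (hC n))
    (fun n => relfinrank_pos_left (le_inf hCA (hC n)) inf_le_left hf)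
    (fun n => relfinrank_le_left (le_inf hCA (hC n)) inf_le_left hf)
  refine ⟨n, fun x hx => ?_⟩
  obtain ⟨m, hm⟩ := hA x hx
  exact (hn m ⟨hx, hm⟩).2

theorem exists_le_of_le_iSup {A C : Subfield K} (hCA : C ≤ A) (hf : 0 < C.relfinrank A)
    {B : ℕ → Subfield K} (hB : Monotone B) (hC : ∀ n, C ≤ B n)
    (hA : A ≤ ⨆ n, B n) : ∃ n, A ≤ B n :=
  exists_le_of_forall_mem hCA hf hB hC fun _ hx =>
    (Subfield.mem_iSup_of_directed hB.directed_le).1 (hA hx)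

/-- The degree of the compositum over one of its two factors. -/
theorem finrank_adjoin_eq_relfinrank {F : Type*} [Field F] [Algebra F K]
    (A B : IntermediateField F K) :
    Module.finrank B (IntermediateField.adjoin B (A : Set K)) =
      B.toSubfield.relfinrank (B.toSubfield ⊔ A.toSubfield) := by
  have key : IntermediateField.adjoin B (A : Set K) =
      IntermediateField.extendScalars (le_sup_left : B ≤ B ⊔ A) := by
    apply le_antisymm
    · rw [IntermediateField.adjoin_le_iff]
      intro x hx
      exact (le_sup_right : A ≤ B ⊔ A) hx
    · rw [IntermediateField.extendScalars_le_iff]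
      apply sup_le
      · intro x hx
        rw [IntermediateField.mem_restrictScalars]
        exact (IntermediateField.adjoin B (A : Set K)).algebraMap_mem ⟨x, hx⟩
      · intro x hx
        rw [IntermediateField.mem_restrictScalars]
        exact IntermediateField.subset_adjoin B (A : Set K) hx
  rw [← IntermediateField.sup_toSubfield, key]
  exact (IntermediateField.relfinrank_eq_finrank_of_le le_sup_left).symm

/-- An F-basis of A spans the compositum over B. If it has no more elements than the dimension of
the compositum, it is independent over B. -/
theorem linearDisjoint_of_finrank_le {F : Type*} [Field F] [Algebra F K]
    (A B : IntermediateField F K) [FiniteDimensional F A]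
    (h : Module.finrank F A ≤ Module.finrank B (IntermediateField.adjoin B (A : Set K))) :
    A.LinearDisjoint B := by
  let b := Module.finBasis F A
  refine IntermediateField.LinearDisjoint.of_basis_left b ?_
  have h1 := IntermediateField.adjoin_rank_le_of_isAlgebraic_right B A
  have h2 := Cardinal.toNat_le_toNat h1 (Module.rank_lt_aleph0 _ _)
  have h3 : (IntermediateField.adjoin B (A.toSubalgebra : Set K)).toSubalgebra =
      Algebra.adjoin B (A.toSubalgebra : Set K) :=
    A.adjoin_intermediateField_toSubalgebra_of_isAlgebraic_right B
  have h4 := Subalgebra.adjoin_eq_span_basis (L := A.toSubalgebra) B b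
  have h5 := (Subalgebra.equivOfEq _ _ h3).toLinearEquiv.finrank_eq
  rw [linearIndependent_iff_card_eq_finrank_span, Fintype.card_fin]
  refine (h.antisymm h2).trans (h5.trans ?_)
  change Module.finrank B (Subalgebra.toSubmodule (Algebra.adjoin B (A.toSubalgebra : Set K))) = _
  rw [h4]
  rfl

/-- A finite extension whose degree does not drop under a base change is linearly disjoint from
the new base. -/
theorem linearDisjoint_of_relfinrank_le {D A B : Subfield K} (hA : D ≤ A) (hB : D ≤ B)
    (hf : 0 < D.relfinrank A) (h : D.relfinrank A ≤ B.relfinrank (B ⊔ A)) :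
    (Subfield.extendScalars hA).LinearDisjoint (Subfield.extendScalars hB) := by
  rw [Subfield.relfinrank_eq_finrank_of_le hA] at hf h
  have : FiniteDimensional D (Subfield.extendScalars hA) := FiniteDimensional.of_finrank_pos hf
  apply linearDisjoint_of_finrank_le
  rwa [finrank_adjoin_eq_relfinrank, Subfield.extendScalars_toSubfield,
    Subfield.extendScalars_toSubfield]

theorem relfinrank_sup_of_linearDisjoint {D A B : Subfield K} (hA : D ≤ A) (hB : D ≤ B)
    (hf : 0 < D.relfinrank A)
    (h : (Subfield.extendScalars hA).LinearDisjoint (Subfield.extendScalars hB)) :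
    B.relfinrank (B ⊔ A) = D.relfinrank A := by
  rw [Subfield.relfinrank_eq_finrank_of_le hA] at hf ⊢
  have : FiniteDimensional D (Subfield.extendScalars hA) := FiniteDimensional.of_finrank_pos hf
  have h1 := finrank_adjoin_eq_relfinrank (Subfield.extendScalars hA) (Subfield.extendScalars hB)
  rw [Subfield.extendScalars_toSubfield, Subfield.extendScalars_toSubfield] at h1
  rw [← h1]
  exact congrArg Cardinal.toNat h.adjoin_rank_eq_rank_left_of_isAlgebraic_left

/-- Linear disjointness from `B` passes to the union of a sequence of extensions. -/
theorem linearDisjoint_of_directed {F : Type*} [Field F] [Algebra F K]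
    (A B : IntermediateField F K) {C : ℕ → IntermediateField F K} (hC : Monotone C)
    (hCB : ∀ n, (C n).LinearDisjoint B) (hA : ∀ x ∈ A, ∃ n, x ∈ C n) : A.LinearDisjoint B := by
  obtain ⟨ι, b⟩ : Nonempty (Σ ι : Type _, Module.Basis ι F A) := ⟨_, Module.Free.chooseBasis F A⟩
  refine IntermediateField.LinearDisjoint.of_basis_left b ?_
  rw [linearIndependent_iff_finset_linearIndependent]
  intro s
  choose n hn using fun i => hA (b i) (b i).2
  have hmem : ∀ i : s, (b i : K) ∈ C (s.sup n) := fun i => hC (Finset.le_sup i.2) (hn i)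
  have hb : LinearIndependent F (fun i : s => (b i : K)) :=
    (b.linearIndependent.comp _ Subtype.val_injective).map' A.val.toLinearMap
      (LinearMap.ker_eq_bot.2 A.val.injective)
  have hc : LinearIndependent F (fun i : s => (⟨b i, hmem i⟩ : C (s.sup n))) :=
    LinearIndependent.of_comp (C (s.sup n)).val.toLinearMap hb
  have hd := (hCB (s.sup n)).linearIndependent_left hc
  exact hd

end Degree

/-! ### The fields L(A^(p^r)), the fields of p^n-th roots, and step degrees. -/

section Frobenius

variable {K : Type*} [Field K] (p : ℕ) [Fact p.Prime] [CharP K p]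

/-- The subfield `A^(p^r)`. -/
noncomputable def powSubfield (r : ℕ) (A : Subfield K) : Subfield K :=
  A.map (iterateFrobenius K p r)

/-- The subfield `L(A^(p^r))`. -/
noncomputable def powSup (L : Subfield K) (r : ℕ) (A : Subfield K) : Subfield K :=
  L ⊔ powSubfield p r A

/-- The degree of `L(A^(p^r))` over `L(A^(p^(r+1)))`. -/
noncomputable def powDegree (L : Subfield K) (r : ℕ) (A : Subfield K) : ℕ :=
  (powSup p L (r + 1) A).relfinrank (powSup p L r A)

/-- The subfield of the elements whose `p^n`-th power lies in `L`. -/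
noncomputable def rootSubfield (L : Subfield K) (n : ℕ) : Subfield K :=
  L.comap (iterateFrobenius K p n)

variable {p}

theorem mem_powSubfield {r : ℕ} {A : Subfield K} {x : K} :
    x ∈ powSubfield p r A ↔ ∃ y ∈ A, y ^ p ^ r = x := by
  simp [powSubfield, Subfield.mem_map, iterateFrobenius_def]

theorem mem_rootSubfield {n : ℕ} {L : Subfield K} {x : K} :
    x ∈ rootSubfield p L n ↔ x ^ p ^ n ∈ L := by
  simp [rootSubfield, Subfield.mem_comap, iterateFrobenius_def]

theorem powSubfield_le (r : ℕ) (A : Subfield K) : powSubfield p r A ≤ A := by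
  intro x hx
  obtain ⟨y, hy, rfl⟩ := mem_powSubfield.1 hx
  exact pow_mem hy _

theorem powSubfield_mono (r : ℕ) {A B : Subfield K} (h : A ≤ B) :
    powSubfield p r A ≤ powSubfield p r B :=
  (Subfield.gc_map_comap _).monotone_l h

theorem powSubfield_sup (r : ℕ) (A B : Subfield K) :
    powSubfield p r (A ⊔ B) = powSubfield p r A ⊔ powSubfield p r B :=
  Subfield.map_sup _ _ _

theorem powSubfield_zero (A : Subfield K) : powSubfield p 0 A = A := by
  ext x; simp [mem_powSubfield]

theorem powSubfield_powSubfield (r s : ℕ) (A : Subfield K) :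
    powSubfield p r (powSubfield p s A) = powSubfield p (r + s) A := by
  ext x
  simp only [mem_powSubfield]
  constructor
  · rintro ⟨_, ⟨y, hy, rfl⟩, rfl⟩
    exact ⟨y, hy, by rw [← pow_mul, ← pow_add, add_comm]⟩
  · rintro ⟨y, hy, rfl⟩
    exact ⟨_, ⟨y, hy, rfl⟩, by rw [← pow_mul, ← pow_add, add_comm]⟩

theorem powSubfield_antitone {r s : ℕ} (h : r ≤ s) (A : Subfield K) :
    powSubfield p s A ≤ powSubfield p r A := by
  obtain ⟨c, rfl⟩ := Nat.exists_eq_add_of_le h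
  rw [← powSubfield_powSubfield]
  exact powSubfield_mono _ (powSubfield_le _ _)

theorem relfinrank_powSubfield (r : ℕ) (A B : Subfield K) :
    (powSubfield p r A).relfinrank (powSubfield p r B) = A.relfinrank B :=
  Subfield.relfinrank_map_map _ _ _

theorem le_powSup (L : Subfield K) (r : ℕ) (A : Subfield K) : L ≤ powSup p L r A := le_sup_left

theorem powSup_le {L A : Subfield K} (h : L ≤ A) (r : ℕ) : powSup p L r A ≤ A :=
  sup_le h (powSubfield_le _ _)

theorem powSup_mono {L L' : Subfield K} (hL : L ≤ L') (r : ℕ) {A B : Subfield K} (h : A ≤ B) :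
    powSup p L r A ≤ powSup p L' r B :=
  sup_le_sup hL (powSubfield_mono r h)

theorem powSup_antitone (L : Subfield K) {r s : ℕ} (h : r ≤ s) (A : Subfield K) :
    powSup p L s A ≤ powSup p L r A :=
  sup_le_sup_left (powSubfield_antitone h A) L

theorem powSup_zero {L A : Subfield K} (h : L ≤ A) : powSup p L 0 A = A := by
  rw [powSup, powSubfield_zero, sup_eq_right.2 h]

theorem powSup_powSup_of_le {L L' : Subfield K} (h : L ≤ L') (r s : ℕ) (A : Subfield K) :
    powSup p L' r (powSup p L s A) = powSup p L' (r + s) A := by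
  rw [powSup, powSup, powSup, powSubfield_sup, powSubfield_powSubfield, ← sup_assoc,
    sup_eq_left.2 ((powSubfield_le r L).trans h)]

theorem powSup_powSup (L : Subfield K) (r s : ℕ) (A : Subfield K) :
    powSup p L r (powSup p L s A) = powSup p L (r + s) A :=
  powSup_powSup_of_le le_rfl r s A

theorem powSup_sup (L : Subfield K) (r : ℕ) (A B : Subfield K) :
    powSup p L r (A ⊔ B) = powSup p L r A ⊔ powSup p L r B := by
  rw [powSup, powSup, powSup, powSubfield_sup, sup_sup_distrib_left]

theorem powSup_sup_of_le {L L' : Subfield K} (h : L ≤ L') (r : ℕ) (A : Subfield K) :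
    powSup p L' r (L' ⊔ A) = L' ⊔ powSup p L r A := by
  rw [powSup, powSup, powSubfield_sup, ← sup_assoc, ← sup_assoc,
    sup_eq_left.2 (powSubfield_le r L'), sup_eq_left.2 h]

theorem powDegree_powSup (L : Subfield K) (r s : ℕ) (A : Subfield K) :
    powDegree p L r (powSup p L s A) = powDegree p L (r + s) A := by
  rw [powDegree, powDegree, powSup_powSup, powSup_powSup, add_right_comm]

theorem powSup_succ (L : Subfield K) (r : ℕ) (A : Subfield K) :
    powSup p L (r + 1) A = powSup p L 1 (powSup p L r A) := by
  rw [powSup_powSup, add_comm]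

theorem powSup_relfinrank_pos {L A : Subfield K} (h : L ≤ A) (hf : 0 < L.relfinrank A) (r : ℕ) :
    0 < L.relfinrank (powSup p L r A) :=
  relfinrank_pos_left (le_powSup L r A) (powSup_le h r) hf

theorem powDegree_pos {L A : Subfield K} (h : L ≤ A) (hf : 0 < L.relfinrank A) (r : ℕ) :
    0 < powDegree p L r A :=
  relfinrank_pos_right (le_powSup _ _ _) (powSup_antitone L r.le_succ A)
    (powSup_relfinrank_pos h hf r)

theorem relfinrank_powSup_powSup_le {A B : Subfield K} (h : A ≤ B) (hf : 0 < A.relfinrank B)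
    (L : Subfield K) (r : ℕ) :
    0 < (powSup p L r A).relfinrank (powSup p L r B) ∧
      (powSup p L r A).relfinrank (powSup p L r B) ≤ A.relfinrank B := by
  have := relfinrank_sup_sup_le (powSubfield_mono (p := p) r h)
    (by rwa [relfinrank_powSubfield]) L
  rwa [relfinrank_powSubfield, sup_comm _ L, sup_comm _ L] at this

/-- Compute [B : L(A^p)] through A and through L(B^p), and use [L(B^p) : L(A^p)] ≤ [B : A]. -/
theorem powDegree_zero_mono {L A B : Subfield K} (hL : L ≤ A) (h : A ≤ B)
    (hf : 0 < L.relfinrank B) : powDegree p L 0 A ≤ powDegree p L 0 B := by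
  have hAB : 0 < A.relfinrank B := relfinrank_pos_right hL h hf
  have h1 := relfinrank_powSup_powSup_le h hAB L (p := p) 1
  have h2 := Subfield.relfinrank_mul_relfinrank (powSup_le (p := p) hL 1) h
  have h3 := Subfield.relfinrank_mul_relfinrank
    (powSup_mono (p := p) (le_refl L) 1 h) (powSup_le (hL.trans h) 1)
  rw [powDegree, powDegree, zero_add, powSup_zero hL, powSup_zero (hL.trans h)]
  refine Nat.le_of_mul_le_mul_right (c := A.relfinrank B) ?_ hAB
  rw [h2, ← h3, mul_comm]
  exact Nat.mul_le_mul_left _ h1.2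

theorem powDegree_eq_powDegree_zero (L : Subfield K) (r : ℕ) (A : Subfield K) :
    powDegree p L r A = powDegree p L 0 (powSup p L r A) := by
  rw [powDegree_powSup, zero_add]

theorem powDegree_mono {L A B : Subfield K} (hL : L ≤ A) (h : A ≤ B)
    (hf : 0 < L.relfinrank B) (r : ℕ) : powDegree p L r A ≤ powDegree p L r B := by
  rw [powDegree_eq_powDegree_zero, powDegree_eq_powDegree_zero L r B]
  exact powDegree_zero_mono (le_powSup _ _ _) (powSup_mono le_rfl r h)
    (powSup_relfinrank_pos (hL.trans h) hf r)

/-- Taking p-th powers and adjoining L again turns step r into step r + 1 and cannot raise a degree.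
-/
theorem powDegree_antitone {L A : Subfield K} (hL : L ≤ A) (hf : 0 < L.relfinrank A) :
    Antitone fun r => powDegree p L r A := by
  apply antitone_nat_of_succ_le
  intro r
  have := relfinrank_powSup_powSup_le (powSup_antitone (p := p) L r.le_succ A)
    (powDegree_pos hL hf r) L (p := p) 1
  rw [← powSup_succ, ← powSup_succ] at this
  exact this.2

theorem powDegree_sup_le {L L' A : Subfield K} (h : L ≤ L') (hL : L ≤ A)
    (hf : 0 < L.relfinrank A) (r : ℕ) :
    powDegree p L' r (L' ⊔ A) ≤ powDegree p L r A := by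
  rw [powDegree, powDegree, powSup_sup_of_le h, powSup_sup_of_le h, sup_comm L', sup_comm L']
  exact (relfinrank_sup_sup_le (powSup_antitone L r.le_succ A) (powDegree_pos hL hf r) L').2

theorem relfinrank_powSup_eq_prod (L : Subfield K) (s R : ℕ) (A : Subfield K) :
    (powSup p L (s + R) A).relfinrank (powSup p L s A) =
      ∏ r ∈ Finset.range R, powDegree p L (s + r) A := by
  induction R with
  | zero => simp
  | succ R ih =>
    rw [Finset.prod_range_succ, ← ih, mul_comm]
    exact (Subfield.relfinrank_mul_relfinrank (powSup_antitone L (Nat.le_succ _) A)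
      (powSup_antitone L (Nat.le_add_right _ _) A)).symm

theorem relfinrank_powSup_le_pow {L : Subfield K} {s R : ℕ} {A : Subfield K} {b : ℕ}
    (h : ∀ r < R, powDegree p L (s + r) A ≤ b) :
    (powSup p L (s + R) A).relfinrank (powSup p L s A) ≤ b ^ R := by
  rw [relfinrank_powSup_eq_prod]
  refine (Finset.prod_le_pow_card _ _ b fun r hr => h r (Finset.mem_range.1 hr)).trans ?_
  rw [Finset.card_range]

theorem pow_le_relfinrank_powSup {L : Subfield K} {s R : ℕ} {A : Subfield K} {b : ℕ}
    (h : ∀ r < R, b ≤ powDegree p L (s + r) A) :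
    b ^ R ≤ (powSup p L (s + R) A).relfinrank (powSup p L s A) := by
  rw [relfinrank_powSup_eq_prod]
  have := Finset.prod_le_prod' (s := Finset.range R) (f := fun _ => b)
    (g := fun r => powDegree p L (s + r) A) fun r hr => h r (Finset.mem_range.1 hr)
  rwa [Finset.prod_const, Finset.card_range] at this

/-- The degree of a finite purely inseparable extension is a power of `p`. -/
theorem exists_relfinrank_eq_pow {A B : Subfield K} (h : A ≤ B) (hf : 0 < A.relfinrank B)
    (hp : ∀ x ∈ B, ∃ n : ℕ, x ^ p ^ n ∈ A) : ∃ n : ℕ, A.relfinrank B = p ^ n := by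
  rw [Subfield.relfinrank_eq_finrank_of_le h] at hf ⊢
  have : FiniteDimensional A (Subfield.extendScalars h) := FiniteDimensional.of_finrank_pos hf
  have : ExpChar A p := (algebraMap A K).expChar (algebraMap A K).injective p
  have : IsPurelyInseparable A (Subfield.extendScalars h) := by
    rw [isPurelyInseparable_iff_pow_mem A p]
    intro x
    obtain ⟨n, hn⟩ := hp x x.2
    exact ⟨n, ⟨⟨_, hn⟩, Subtype.ext rfl⟩⟩
  exact IsPurelyInseparable.finrank_eq_pow A (Subfield.extendScalars h) p

theorem exists_powDegree_eq_pow {L A : Subfield K} (h : L ≤ A) (hf : 0 < L.relfinrank A)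
    (hp : ∀ x : K, ∃ n : ℕ, x ^ p ^ n ∈ L) (r : ℕ) : ∃ n : ℕ, powDegree p L r A = p ^ n :=
  exists_relfinrank_eq_pow (powSup_antitone L r.le_succ A) (powDegree_pos h hf r)
    fun x _ => (hp x).imp fun _ hn => le_powSup L _ A hn

/-- Step degrees are powers of p, so missing p^t means losing a whole factor p. Repeated over many
steps, this loss outgrows any fixed constant. -/
theorem powDegree_le_of_lt {L A : Subfield K} (h : L ≤ A) (hf : 0 < L.relfinrank A)
    (hp : ∀ x : K, ∃ n : ℕ, x ^ p ^ n ∈ L) {r t : ℕ} (hr : powDegree p L r A < p ^ t) :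
    1 ≤ t ∧ powDegree p L r A ≤ p ^ (t - 1) := by
  obtain ⟨n, hn⟩ := exists_powDegree_eq_pow h hf hp r
  have h1 : 1 < p := (Fact.out : p.Prime).one_lt
  rw [hn] at hr ⊢
  have := (Nat.pow_lt_pow_iff_right h1).1 hr
  exact ⟨by omega, Nat.pow_le_pow_right h1.le (by omega)⟩

theorem powSup_eq_of_powSubfield_le {L A : Subfield K} {r : ℕ} (h : powSubfield p r A ≤ L) :
    powSup p L r A = L :=
  sup_eq_left.2 h

theorem powSubfield_rootSubfield_le (L : Subfield K) (n : ℕ) :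
    powSubfield p n (rootSubfield p L n) ≤ L := by
  intro x hx
  obtain ⟨y, hy, rfl⟩ := mem_powSubfield.1 hx
  exact mem_rootSubfield.1 hy

theorem rootSubfield_mono {L L' : Subfield K} (h : L ≤ L') (n : ℕ) :
    rootSubfield p L n ≤ rootSubfield p L' n := fun _ hx =>
  mem_rootSubfield.2 (h (mem_rootSubfield.1 hx))

theorem rootSubfield_rootSubfield (L : Subfield K) (m n : ℕ) :
    rootSubfield p (rootSubfield p L m) n = rootSubfield p L (m + n) := by
  ext x
  rw [mem_rootSubfield, mem_rootSubfield, mem_rootSubfield, ← pow_mul, ← pow_add, add_comm]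

theorem le_rootSubfield (L : Subfield K) (n : ℕ) : L ≤ rootSubfield p L n := fun _ hx =>
  mem_rootSubfield.2 (pow_mem hx _)

theorem monotone_rootSubfield (L : Subfield K) : Monotone (rootSubfield p L) := by
  intro m n h
  obtain ⟨c, rfl⟩ := Nat.exists_eq_add_of_le h
  rw [← rootSubfield_rootSubfield]
  exact le_rootSubfield _ _

theorem powSubfield_top_inf (L : Subfield K) (n : ℕ) :
    powSubfield p n ⊤ ⊓ L = powSubfield p n (rootSubfield p L n) := by
  ext x
  simp only [Subfield.mem_inf, mem_powSubfield, mem_rootSubfield]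
  constructor
  · rintro ⟨⟨y, -, rfl⟩, h⟩
    exact ⟨y, h, rfl⟩
  · rintro ⟨y, h, rfl⟩
    exact ⟨⟨y, Subfield.mem_top _, rfl⟩, h⟩

theorem powSubfield_rootSubfield_add_le (L : Subfield K) (m n : ℕ) :
    powSubfield p n (rootSubfield p L (m + n)) ≤ rootSubfield p L m := by
  rw [← rootSubfield_rootSubfield]
  exact powSubfield_rootSubfield_le _ _

/-- A finite subextension is contained in one of the fields `rootSubfield p L n`. -/
theorem exists_le_rootSubfield {L A : Subfield K} (h : L ≤ A) (hf : 0 < L.relfinrank A)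
    (hp : ∀ x : K, ∃ n : ℕ, x ^ p ^ n ∈ L) : ∃ n, A ≤ rootSubfield p L n :=
  exists_le_of_forall_mem h hf (monotone_rootSubfield L) (le_rootSubfield L) fun x _ =>
    (hp x).imp fun _ => mem_rootSubfield.2

end Frobenius

/-- The difference N j - t j is nonincreasing from J on and bounded below, hence eventually
constant. The defect `g` measures its total drop since J; by `h3` its subtraction never truncates,
and j₀ is where it is maximal. -/
theorem exists_forall_add_eq {N : ℕ → ℕ} {t C J : ℕ} (h1 : ∀ j ≥ J, N (j + 1) ≤ N j + t)
    (h2 : ∀ j, t * (j - C) ≤ N j) : ∃ j₀ ≥ J, ∀ i, N (j₀ + i) = N j₀ + t * i := by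
  have h3 : ∀ j ≥ J, ∀ i, N (j + i) ≤ N j + t * i := by
    intro j hj i
    induction i with
    | zero => simp
    | succ i ih =>
      have := h1 (j + i) (by omega)
      rw [← add_assoc, mul_add]
      omega
  let g : ℕ → ℕ := fun i => N J + t * i - N (J + i)
  have hbd : BddAbove (Set.range g) := by
    refine ⟨N J + t * C, ?_⟩
    rintro _ ⟨i, rfl⟩
    have := h2 (J + i)
    have h4 : t * i ≤ t * (J + i - C) + t * C := by
      rw [← mul_add]
      exact Nat.mul_le_mul_left _ (by omega)
    simp only [g]
    omega
  obtain ⟨i₀, hi⟩ := Nat.sSup_mem (Set.range_nonempty g) hbd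
  refine ⟨J + i₀, by omega, fun i => le_antisymm (h3 _ (by omega) i) ?_⟩
  have h4 : g (i₀ + i) ≤ g i₀ := hi ▸ le_csSup hbd ⟨_, rfl⟩
  have h5 := h3 J le_rfl i₀
  have h6 := h3 J le_rfl (i₀ + i)
  simp only [g, mul_add, ← add_assoc] at h4 h6
  omega

/-! ### The relatively perfect closure, and modularity from large exponents. -/

section Closure

variable {K : Type*} [Field K] {p : ℕ} [Fact p.Prime] [CharP K p] {κ P : Subfield K}

/-- In the `q`-finite case, `K` is generated by `κ(K^p)` and one of the fields
`rootSubfield p κ n`. -/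
theorem exists_powSup_sup_rootSubfield_eq_top (hp : ∀ x : K, ∃ n : ℕ, x ^ p ^ n ∈ κ)
    (hfin : ∀ n, 0 < κ.relfinrank (rootSubfield p κ n)) {d : ℕ}
    (hd : ∀ n, powDegree p κ 0 (rootSubfield p κ n) ≤ d) :
    ∃ J, powSup p κ 1 ⊤ ⊔ rootSubfield p κ J = ⊤ := by
  have h1 : ∀ n, 0 < (powSup p κ 1 ⊤).relfinrank (powSup p κ 1 ⊤ ⊔ rootSubfield p κ n) ∧
      (powSup p κ 1 ⊤).relfinrank (powSup p κ 1 ⊤ ⊔ rootSubfield p κ n) ≤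
        powDegree p κ 0 (rootSubfield p κ n) := by
    intro n
    have hn := powDegree_pos (le_rootSubfield κ n) (hfin n) 0
    rw [powDegree, powSup_zero (le_rootSubfield κ n), zero_add] at hn ⊢
    exact relfinrank_sup_le _ _ (powSup_mono le_rfl 1 le_top) (powSup_le (le_rootSubfield κ n) 1) hn
  obtain ⟨J, hJ⟩ := exists_forall_le_of_relfinrank_le
    (B := fun n => powSup p κ 1 ⊤ ⊔ rootSubfield p κ n)
    (fun m n h => sup_le_sup_left (monotone_rootSubfield κ h) _) (fun n => le_sup_left)
    (fun n => (h1 n).1) (fun n => (h1 n).2.trans (hd n))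
  refine ⟨J, top_le_iff.1 fun x _ => ?_⟩
  obtain ⟨n, hn⟩ := hp x
  exact hJ n ((le_sup_right : rootSubfield p κ n ≤ _) (mem_rootSubfield.2 hn))

theorem powSup_top_sup_rootSubfield_eq_top {J : ℕ}
    (hJ : powSup p κ 1 ⊤ ⊔ rootSubfield p κ J = ⊤) (r : ℕ) :
    powSup p κ r ⊤ ⊔ rootSubfield p κ J = ⊤ := by
  induction r with
  | zero => rw [powSup_zero le_top, top_sup_eq]
  | succ r ih =>
    rw [powSup_succ]
    conv_rhs => rw [← hJ, ← ih, powSup_sup, sup_assoc,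
      sup_eq_right.2 (powSup_le (le_rootSubfield κ J) 1)]

/-- Raise K = κ(K^p)κ_J to the power p^J and adjoin κ: the factor κ_J falls into κ and disappears.
-/
theorem powSup_succ_top_eq {J : ℕ} (hJ : powSup p κ 1 ⊤ ⊔ rootSubfield p κ J = ⊤) :
    powSup p κ 1 (powSup p κ J ⊤) = powSup p κ J ⊤ := by
  conv_rhs => rw [← hJ, powSup_sup, powSup_powSup,
    powSup_eq_of_powSubfield_le (powSubfield_rootSubfield_le κ J),
    sup_eq_left.2 (le_powSup _ _ _)]
  rw [powSup_powSup, add_comm]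

theorem powSup_eq_self (h1 : powSup p κ 1 P = P) (hκ : κ ≤ P) (r : ℕ) : powSup p κ r P = P := by
  induction r with
  | zero => exact powSup_zero hκ
  | succ r ih => rw [powSup_succ, ih, h1]

theorem le_iSup_inf_rootSubfield (hp : ∀ x : K, ∃ n : ℕ, x ^ p ^ n ∈ κ) (P : Subfield K) :
    P ≤ ⨆ n, P ⊓ rootSubfield p κ n := by
  intro x hx
  obtain ⟨n, hn⟩ := hp x
  exact le_iSup (fun n => P ⊓ rootSubfield p κ n) n ⟨hx, mem_rootSubfield.2 hn⟩

/-- A finite subextension of a relatively perfect extension `P/κ` is contained in some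
`κ(P_n^(p^r))`. -/
theorem exists_le_powSup_inf_rootSubfield (hp : ∀ x : K, ∃ n : ℕ, x ^ p ^ n ∈ κ)
    (h1 : powSup p κ 1 P = P) (hκ : κ ≤ P) {A : Subfield K} (hA : κ ≤ A)
    (hf : 0 < κ.relfinrank A) (hAP : A ≤ P) (r : ℕ) :
    ∃ n, A ≤ powSup p κ r (P ⊓ rootSubfield p κ n) := by
  refine exists_le_of_le_iSup hA hf
    (fun m n h => powSup_mono le_rfl r (inf_le_inf_left P (monotone_rootSubfield κ h)))
    (fun n => le_powSup _ _ _) ?_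
  refine hAP.trans ?_
  conv_lhs => rw [← powSup_eq_self h1 hκ r]
  refine sup_le (le_iSup_of_le 0 (le_powSup _ _ _)) ?_
  intro x hx
  obtain ⟨y, hy, rfl⟩ := mem_powSubfield.1 hx
  obtain ⟨n, hn⟩ := hp y
  exact le_iSup (fun n => powSup p κ r (P ⊓ rootSubfield p κ n)) n
    ((le_sup_right : powSubfield p r _ ≤ _)
      (mem_powSubfield.2 ⟨y, ⟨hy, mem_rootSubfield.2 hn⟩, rfl⟩))

theorem inf_rootSubfield_relfinrank_pos (hκ : κ ≤ P)
    (hfin : ∀ n, 0 < κ.relfinrank (rootSubfield p κ n)) (n : ℕ) :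
    0 < κ.relfinrank (P ⊓ rootSubfield p κ n) :=
  relfinrank_pos_left (le_inf hκ (le_rootSubfield κ n)) inf_le_right (hfin n)

/-- For all `j`, the number of exponents of `κ_j/κ` that are at least `j - C` is at least `s`. -/
def HasLargeExponents (p : ℕ) [Fact p.Prime] [CharP K p] (κ : Subfield K) (s : ℕ) : Prop :=
  ∃ C, ∀ j r, r + C < j → p ^ s ≤ powDegree p κ r (rootSubfield p κ j)

/-- Discarding the first J steps puts κ_j inside P, where at most t generators are needed. So at
most t exponents of κ_j/κ exceed J, however large j is. -/
theorem not_hasLargeExponents_succ (hκ : κ ≤ P)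
    (hfin : ∀ n, 0 < κ.relfinrank (rootSubfield p κ n)) {J t : ℕ}
    (hJ : powSup p κ J ⊤ ≤ P)
    (ht : ∀ n, powDegree p κ 0 (P ⊓ rootSubfield p κ n) ≤ p ^ t) :
    ¬ HasLargeExponents p κ (t + 1) := by
  rintro ⟨C, hC⟩
  have h1 := hC (J + C + 1) J (by omega)
  rw [powDegree_eq_powDegree_zero] at h1
  have h2 : powSup p κ J (rootSubfield p κ (J + C + 1)) ≤ P ⊓ rootSubfield p κ (J + C + 1) :=
    le_inf ((powSup_mono le_rfl J le_top).trans hJ) (powSup_le (le_rootSubfield _ _) _)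
  have h3 := (h1.trans (powDegree_zero_mono (le_powSup _ _ _) h2
    (inf_rootSubfield_relfinrank_pos hκ hfin _))).trans (ht _)
  have := (Nat.pow_le_pow_iff_right (Fact.out : p.Prime).one_lt).1 h3
  omega

/-- Over κ_j with j ≥ J, all of K comes from P. A finite A therefore lies in κ_j(P ∩ κ_m) for some
m, and base change from κ to κ_j does not raise step degrees. -/
theorem powDegree_rootSubfield_le (hp : ∀ x : K, ∃ n : ℕ, x ^ p ^ n ∈ κ) (hκ : κ ≤ P)
    (hfin : ∀ n, 0 < κ.relfinrank (rootSubfield p κ n)) {J t : ℕ}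
    (hPJ : P ⊔ rootSubfield p κ J = ⊤)
    (ht : ∀ n, powDegree p κ 0 (P ⊓ rootSubfield p κ n) ≤ p ^ t) {j : ℕ} (hj : J ≤ j)
    {A : Subfield K} (hA : rootSubfield p κ j ≤ A) (hf : 0 < κ.relfinrank A) (r : ℕ) :
    powDegree p (rootSubfield p κ j) r A ≤ p ^ t := by
  have hf' := relfinrank_pos_right (le_rootSubfield κ j) hA hf
  refine (powDegree_antitone hA hf' r.zero_le).trans ?_
  obtain ⟨m, hm⟩ := exists_le_of_le_iSup hA hf'
    (B := fun m => rootSubfield p κ j ⊔ (P ⊓ rootSubfield p κ m))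
    (fun m n h => sup_le_sup_left (inf_le_inf_left P (monotone_rootSubfield κ h)) _)
    (fun n => le_sup_left) (by
      refine le_top.trans (hPJ.ge.trans (sup_le ?_ ?_))
      · exact (le_iSup_inf_rootSubfield hp P).trans (iSup_mono fun n => le_sup_right)
      · exact (monotone_rootSubfield κ hj).trans
          (le_iSup_of_le 0 le_sup_left))
  have hPm := inf_rootSubfield_relfinrank_pos hκ hfin m
  have hκm : κ ≤ P ⊓ rootSubfield p κ m := le_inf hκ (le_rootSubfield κ m)
  refine (powDegree_mono hA hm ?_ 0).trans
    ((powDegree_sup_le (le_rootSubfield κ j) hκm hPm 0).trans (ht m))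
  exact (relfinrank_sup_le _ _ (le_rootSubfield κ j) hκm hPm).1

theorem exists_linDisjointOverInf (hp : ∀ x : K, ∃ n : ℕ, x ^ p ^ n ∈ κ) (hκ : κ ≤ P)
    (hfin : ∀ n, 0 < κ.relfinrank (rootSubfield p κ n)) {J t : ℕ}
    (hPJ : P ⊔ rootSubfield p κ J = ⊤)
    (ht : ∀ n, powDegree p κ 0 (P ⊓ rootSubfield p κ n) ≤ p ^ t)
    (hlarge : HasLargeExponents p κ t) :
    ∃ j, ∀ n, LinDisjointOverInf (powSubfield p n ⊤) (rootSubfield p κ j) := by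
  obtain ⟨C, hC⟩ := hlarge
  have hp1 : 1 < p := (Fact.out : p.Prime).one_lt
  choose N hN using fun j => exists_relfinrank_eq_pow (le_rootSubfield κ j) (hfin j)
    fun x _ => hp x
  have hlow : ∀ j, t * (j - C) ≤ N j := by
    intro j
    have h1 := pow_le_relfinrank_powSup (p := p) (L := κ) (s := 0) (R := j - C)
      (A := rootSubfield p κ j) (b := p ^ t) fun r hr => by
        rw [zero_add]; exact hC j r (by omega)
    rw [zero_add, powSup_zero (le_rootSubfield κ j), ← pow_mul] at h1
    have h2 := relfinrank_le_right (le_powSup κ (j - C) _)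
      (powSup_le (le_rootSubfield κ j) (j - C)) (hfin j)
    rw [hN] at h2
    exact (Nat.pow_le_pow_iff_right hp1).1 (h1.trans h2)
  -- The extension κ_(j+1)/κ_j has exponent at most 1, so its degree is its step degree at 0, at
  -- most p^t.
  have hstep : ∀ j ≥ J, N (j + 1) ≤ N j + t := by
    intro j hj
    have h1 := powDegree_rootSubfield_le hp hκ hfin hPJ ht hj
      (monotone_rootSubfield κ j.le_succ) (hfin _) 0
    rw [powDegree, powSup_zero (monotone_rootSubfield κ j.le_succ), zero_add,
      powSup_eq_of_powSubfield_le (powSubfield_rootSubfield_add_le κ j 1)] at h1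
    have h2 := Subfield.relfinrank_mul_relfinrank (le_rootSubfield κ j)
      (monotone_rootSubfield (p := p) κ j.le_succ)
    rw [hN, hN] at h2
    rw [← Nat.pow_le_pow_iff_right hp1, pow_add, ← h2]
    exact Nat.mul_le_mul_left _ h1
  obtain ⟨j₀, hj₀, heq⟩ := exists_forall_add_eq hstep hlow
  have hrel : ∀ i m, (rootSubfield p κ (j₀ + i)).relfinrank (rootSubfield p κ (j₀ + i + m)) =
      p ^ (t * m) := by
    intro i m
    have h2 := Subfield.relfinrank_mul_relfinrank (le_rootSubfield κ (j₀ + i))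
      (monotone_rootSubfield (p := p) κ (Nat.le_add_right (j₀ + i) m))
    rw [hN, hN, add_assoc, heq, heq, mul_add, ← add_assoc (N j₀),
      pow_add _ _ (t * m)] at h2
    rw [add_assoc]
    exact Nat.eq_of_mul_eq_mul_left (pow_pos (by omega) _) h2
  refine ⟨j₀, fun n => ?_⟩
  have hD : powSubfield p n ⊤ ⊓ rootSubfield p κ j₀ =
      powSubfield p n (rootSubfield p κ (j₀ + n)) := by
    rw [powSubfield_top_inf, rootSubfield_rootSubfield]
  have hDB : ∀ i, powSubfield p n ⊤ ⊓ rootSubfield p κ j₀ ≤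
      powSubfield p n (rootSubfield p κ (j₀ + n + i)) := fun i =>
    hD.le.trans (powSubfield_mono n (monotone_rootSubfield κ (Nat.le_add_right _ _)))
  -- K^(p^n) is the union over i of the p^n-th powers of κ_(j₀+n+i), each finite over K^(p^n) ∩
  -- κ_(j₀).
  refine linearDisjoint_of_directed _ _ (C := fun i => Subfield.extendScalars (hDB i))
    (fun i m h => powSubfield_mono n (monotone_rootSubfield κ (Nat.add_le_add_left h _))) ?_ ?_
  · intro i
    have h1 : (powSubfield p n ⊤ ⊓ rootSubfield p κ j₀).relfinrank
        (powSubfield p n (rootSubfield p κ (j₀ + n + i))) = p ^ (t * i) := by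
      rw [hD, relfinrank_powSubfield, hrel]
    refine linearDisjoint_of_relfinrank_le (hDB i) _ (h1 ▸ pow_pos (by omega) _) ?_
    rw [h1]
    change _ ≤ (rootSubfield p κ j₀).relfinrank (powSup p _ n _)
    have hle : rootSubfield p κ j₀ ≤ rootSubfield p κ (j₀ + n + i) :=
      monotone_rootSubfield κ (by omega)
    have h2 := Subfield.relfinrank_mul_relfinrank (le_powSup (p := p) (rootSubfield p κ j₀) n _)
      (powSup_le hle n)
    have h3 := relfinrank_powSup_le_pow (p := p) (L := rootSubfield p κ j₀) (s := 0) (R := n)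
      (A := rootSubfield p κ (j₀ + n + i)) (b := p ^ t) fun r _ =>
        powDegree_rootSubfield_le hp hκ hfin hPJ ht hj₀ hle (hfin _) _
    rw [zero_add, powSup_zero hle] at h3
    have h4 := hrel 0 (n + i)
    rw [add_zero, ← add_assoc] at h4
    rw [h4] at h2
    -- The total degree over κ_(j₀) is p^(t(n+i)) and the top n steps take at most p^(tn). What
    -- remains is at least p^(ti), the degree before adjoining κ_(j₀).
    have h5 : p ^ (t * i) * (p ^ t) ^ n = p ^ (t * (n + i)) := by
      rw [← pow_mul, ← pow_add, mul_add, add_comm]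
    refine Nat.le_of_mul_le_mul_right (c := (p ^ t) ^ n) ?_ (pow_pos (pow_pos (by omega) _) _)
    rw [h5, ← h2]
    exact Nat.mul_le_mul_left _ h3
  · intro x hx
    obtain ⟨y, -, rfl⟩ := mem_powSubfield.1 (hx : x ∈ powSubfield p n ⊤)
    obtain ⟨i, hi⟩ := hp y
    exact ⟨i, mem_powSubfield.2 ⟨y, monotone_rootSubfield κ (by omega)
      (mem_rootSubfield.2 hi), rfl⟩⟩

end Closure

/-! ### Large exponents from modularity. -/

section Modular

variable {K : Type*} [Field K] {p : ℕ} [Fact p.Prime] [CharP K p] {κ P L : Subfield K}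

/-- Write L_m for the p^m-th roots of L in K. Frobenius carries L_m/L_r to an extension of K^(p^r) ∩
L inside K^(p^r), and modularity preserves its degree after adjoining L. -/
theorem relfinrank_powSup_rootSubfield
    (hmod : ∀ n, LinDisjointOverInf (powSubfield p n ⊤) L)
    (hfin : ∀ n, 0 < L.relfinrank (rootSubfield p L n)) {r m : ℕ} (h : r ≤ m) :
    L.relfinrank (powSup p L r (rootSubfield p L m)) =
      (rootSubfield p L r).relfinrank (rootSubfield p L m) := by
  have hD := powSubfield_top_inf (p := p) L r
  have hle := monotone_rootSubfield (p := p) L h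
  have hDB : powSubfield p r ⊤ ⊓ L ≤ powSubfield p r (rootSubfield p L m) :=
    hD.le.trans (powSubfield_mono r hle)
  have h1 : (powSubfield p r ⊤ ⊓ L).relfinrank (powSubfield p r (rootSubfield p L m)) =
      (rootSubfield p L r).relfinrank (rootSubfield p L m) := by
    rw [hD, relfinrank_powSubfield]
  rw [← h1]
  refine relfinrank_sup_of_linearDisjoint hDB inf_le_right ?_ ?_
  · rw [h1]
    exact relfinrank_pos_right (le_rootSubfield L r) hle (hfin m)
  · exact IntermediateField.LinearDisjoint.of_le_left (hmod r) (powSubfield_mono r le_top)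

/-- Divide two consecutive cases of `relfinrank_powSup_rootSubfield`. The point is that the
right-hand side no longer involves m. -/
theorem powDegree_rootSubfield_eq
    (hmod : ∀ n, LinDisjointOverInf (powSubfield p n ⊤) L)
    (hfin : ∀ n, 0 < L.relfinrank (rootSubfield p L n)) {r m : ℕ} (h : r < m) :
    powDegree p L r (rootSubfield p L m) =
      (rootSubfield p L r).relfinrank (rootSubfield p L (r + 1)) := by
  have h1 := Subfield.relfinrank_mul_relfinrank (le_powSup (p := p) L (r + 1) (rootSubfield p L m))
    (powSup_antitone L r.le_succ _)
  have h2 := Subfield.relfinrank_mul_relfinrank (monotone_rootSubfield (p := p) L r.le_succ)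
    (monotone_rootSubfield L (show r + 1 ≤ m from h))
  rw [relfinrank_powSup_rootSubfield hmod hfin h.le,
    relfinrank_powSup_rootSubfield hmod hfin (show r + 1 ≤ m from h), ← h2, mul_comm] at h1
  exact Nat.eq_of_mul_eq_mul_right (relfinrank_pos_right (le_rootSubfield L _)
    (monotone_rootSubfield L (show r + 1 ≤ m from h)) (hfin m)) h1

/-- A finite extension of the base does not lower the irrationality degree of a relatively perfect
extension. -/
theorem exists_pow_le_powDegree_sup (hp : ∀ x : K, ∃ n : ℕ, x ^ p ^ n ∈ κ)
    (h1 : powSup p κ 1 P = P) (hκ : κ ≤ P)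
    (hfin : ∀ n, 0 < κ.relfinrank (rootSubfield p κ n)) {t : ℕ}
    (ht : ∃ n, p ^ t ≤ powDegree p κ 0 (P ⊓ rootSubfield p κ n))
    (hL : κ ≤ L) (hLf : 0 < κ.relfinrank L) :
    ∃ n, p ^ t ≤ powDegree p L 0 (L ⊔ (P ⊓ rootSubfield p κ n)) := by
  by_contra! hcon
  have hp1 : 1 < p := (Fact.out : p.Prime).one_lt
  have hPf := inf_rootSubfield_relfinrank_pos hκ hfin
  have hκP : ∀ n, κ ≤ P ⊓ rootSubfield p κ n := fun n => le_inf hκ (le_rootSubfield κ n)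
  have hpL : ∀ x : K, ∃ n : ℕ, x ^ p ^ n ∈ L := fun x => (hp x).imp fun _ h => hL h
  have hLPf : ∀ n, 0 < L.relfinrank (L ⊔ (P ⊓ rootSubfield p κ n)) := fun n =>
    (relfinrank_sup_le _ _ hL (hκP n) (hPf n)).1
  have hlt : ∀ n, 1 ≤ t ∧ powDegree p L 0 (L ⊔ (P ⊓ rootSubfield p κ n)) ≤ p ^ (t - 1) := fun n =>
    powDegree_le_of_lt le_sup_left (hLPf n) hpL (hcon n)
  obtain ⟨n, hn⟩ := ht
  -- The number of steps is [L : κ] itself, because R < p^R contradicts the final bound p^R ≤ R.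
  let R := κ.relfinrank L
  obtain ⟨m, hm⟩ := exists_le_powSup_inf_rootSubfield hp h1 hκ (hκP n) (hPf n) inf_le_left R
  set A := P ⊓ rootSubfield p κ m with hA
  have h2 : p ^ t ≤ powDegree p κ R A := by
    rw [powDegree_eq_powDegree_zero]
    exact hn.trans (powDegree_zero_mono (hκP n) hm
      (powSup_relfinrank_pos (hκP m) (hPf m) R))
  have h3 : (p ^ t) ^ R ≤ (powSup p κ R A).relfinrank A := by
    have := pow_le_relfinrank_powSup (p := p) (L := κ) (s := 0) (R := R) (A := A) (b := p ^ t)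
      fun r hr => h2.trans (powDegree_antitone (hκP m) (hPf m) (by omega))
    rwa [zero_add, powSup_zero (hκP m)] at this
  have h4 : (powSup p L R (L ⊔ A)).relfinrank (L ⊔ A) ≤ (p ^ (t - 1)) ^ R := by
    have := relfinrank_powSup_le_pow (p := p) (L := L) (s := 0) (R := R) (A := L ⊔ A)
      (b := p ^ (t - 1)) fun r hr =>
        (powDegree_antitone le_sup_left (hLPf m) (Nat.zero_le _)).trans (hlt m).2
    rwa [zero_add, powSup_zero le_sup_left] at this
  have hWf : 0 < κ.relfinrank (powSup p κ R A) := powSup_relfinrank_pos (hκP m) (hPf m) R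
  have hLAf : 0 < κ.relfinrank (L ⊔ A) := by
    rw [← Subfield.relfinrank_mul_relfinrank hL (le_sup_left : L ≤ L ⊔ A)]
    exact Nat.mul_pos hLf (hLPf m)
  -- With W = κ(A^(p^R)), the degree [A : W] is at most [LA : W] = [LW : W][LA : LW], and [LW : W] ≤
  -- [L : κ] = R.
  have h5 : (powSup p κ R A).relfinrank A ≤
      R * (powSup p L R (L ⊔ A)).relfinrank (L ⊔ A) := by
    have hWA : powSup p κ R A ≤ A := powSup_le (hκP m) R
    rw [powSup_sup_of_le hL]
    have h6 := relfinrank_sup_le (powSup p κ R A) L (le_powSup κ R A) hL hLf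
    rw [sup_comm] at h6
    have h7 := Subfield.relfinrank_mul_relfinrank
      (le_sup_right : powSup p κ R A ≤ L ⊔ powSup p κ R A) (sup_le_sup_left hWA L)
    have h8 := relfinrank_le_left hWA (le_sup_right : A ≤ L ⊔ A)
      (relfinrank_pos_right (le_powSup κ R A) (hWA.trans le_sup_right) hLAf)
    rw [← h7] at h8
    exact h8.trans (Nat.mul_le_mul_right _ h6.2)
  have h6 : p ^ ((t - 1) * R) * p ^ R ≤ R * p ^ ((t - 1) * R) := by
    rw [← pow_add, ← Nat.succ_mul, Nat.succ_eq_add_one, Nat.sub_add_cancel (hlt 0).1, pow_mul,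
      pow_mul]
    exact h3.trans (h5.trans (Nat.mul_le_mul_left _ h4))
  rw [mul_comm] at h6
  have h7 := Nat.le_of_mul_le_mul_right h6 (pow_pos (by omega) _)
  exact absurd (Nat.lt_pow_self hp1 (n := R)) (not_lt.2 h7)

theorem hasLargeExponents_of_linDisjointOverInf (hp : ∀ x : K, ∃ n : ℕ, x ^ p ^ n ∈ κ)
    (h1 : powSup p κ 1 P = P) (hκ : κ ≤ P)
    (hfin : ∀ n, 0 < κ.relfinrank (rootSubfield p κ n)) {t : ℕ}
    (ht : ∃ n, p ^ t ≤ powDegree p κ 0 (P ⊓ rootSubfield p κ n))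
    (hL : κ ≤ L) (hLf : 0 < κ.relfinrank L)
    (hmod : ∀ n, LinDisjointOverInf (powSubfield p n ⊤) L) :
    HasLargeExponents p κ t := by
  have hp1 : 1 < p := (Fact.out : p.Prime).one_lt
  obtain ⟨h, hh⟩ := exists_le_rootSubfield hL hLf hp
  have hMk : ∀ j, rootSubfield p L j ≤ rootSubfield p κ (j + h) := fun j => by
    rw [add_comm, ← rootSubfield_rootSubfield]
    exact rootSubfield_mono hh j
  have hLfin : ∀ n, 0 < L.relfinrank (rootSubfield p L n) := fun n =>
    relfinrank_pos_right hL (le_rootSubfield L n) (relfinrank_pos_left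
      (hL.trans (le_rootSubfield L n)) (hMk n) (hfin _))
  obtain ⟨n, hn⟩ := exists_pow_le_powDegree_sup hp h1 hκ hfin ht hL hLf
  have hκP : ∀ n, κ ≤ P ⊓ rootSubfield p κ n := fun n => le_inf hκ (le_rootSubfield κ n)
  have hdeg : ∀ r m, r < m → p ^ t ≤ powDegree p L r (rootSubfield p L m) := by
    intro r m hrm
    obtain ⟨m', hm'⟩ := exists_le_powSup_inf_rootSubfield hp h1 hκ (hκP n)
      (inf_rootSubfield_relfinrank_pos hκ hfin n) inf_le_left r
    -- By modularity m may be enlarged until L(L_m^(p^r)) contains the given finite piece of LP,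
    -- whose step degree is at least p^t.
    have hM : powDegree p L r (rootSubfield p L m) =
        powDegree p L r (rootSubfield p L (max m m')) := by
      rw [powDegree_rootSubfield_eq hmod hLfin hrm,
        powDegree_rootSubfield_eq hmod hLfin (lt_max_of_lt_left hrm)]
    rw [hM, powDegree_eq_powDegree_zero]
    refine hn.trans (powDegree_zero_mono le_sup_left (sup_le (le_powSup _ _ _) ?_)
      (powSup_relfinrank_pos (le_rootSubfield _ _) (hLfin _) r))
    refine hm'.trans (powSup_mono hL r (inf_le_right.trans ?_))
    exact (rootSubfield_mono hL m').trans (monotone_rootSubfield L (le_max_right _ _))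
  -- Write j = r + c + h. If the step degree at r were at most p^(t-1), comparing degrees over L and
  -- κ would give tc ≤ (t-1)(c+h), that is c ≤ (t-1)h. The constant t h is exactly what excludes
  -- this.
  refine ⟨t * h, fun j r hj => ?_⟩
  by_contra! hcon
  obtain ⟨ht1, hle⟩ := powDegree_le_of_lt (le_rootSubfield κ j) (hfin j) hp hcon
  have hth : h ≤ t * h := Nat.le_mul_of_pos_left h ht1
  obtain ⟨m, rfl⟩ : ∃ m, j = m + h := ⟨j - h, by omega⟩
  obtain ⟨c, rfl⟩ : ∃ c, m = r + c := ⟨m - r, by omega⟩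
  have h2 : (p ^ t) ^ c ≤ L.relfinrank (powSup p L r (rootSubfield p L (r + c))) := by
    have := pow_le_relfinrank_powSup (p := p) (L := L) (s := r) (R := c)
      (A := rootSubfield p L (r + c)) (b := p ^ t) fun i hi => hdeg _ _ (by omega)
    rwa [powSup_eq_of_powSubfield_le (powSubfield_rootSubfield_le L (r + c))] at this
  have hκj := le_rootSubfield (p := p) κ (r + c + h)
  have h3 : κ.relfinrank (powSup p κ r (rootSubfield p κ (r + c + h))) ≤
      (p ^ (t - 1)) ^ (c + h) := by
    have := relfinrank_powSup_le_pow (p := p) (L := κ) (s := r) (R := c + h)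
      (A := rootSubfield p κ (r + c + h)) (b := p ^ (t - 1)) fun i _ =>
        (powDegree_antitone hκj (hfin _) (Nat.le_add_right r i)).trans hle
    rwa [← add_assoc, powSup_eq_of_powSubfield_le (powSubfield_rootSubfield_le κ _)] at this
  have h4 := relfinrank_sup_le L _ hL (le_powSup (p := p) κ r (rootSubfield p κ (r + c + h)))
    (powSup_relfinrank_pos hκj (hfin _) r)
  have h5 : powSup p L r (rootSubfield p L (r + c)) ≤
      L ⊔ powSup p κ r (rootSubfield p κ (r + c + h)) :=
    sup_le le_sup_left ((powSubfield_mono r (hMk _)).trans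
      (le_trans le_sup_right le_sup_right))
  have h6 := (h2.trans (relfinrank_le_left (le_powSup _ _ _) h5 h4.1)).trans (h4.2.trans h3)
  rw [← pow_mul, ← pow_mul, Nat.pow_le_pow_iff_right hp1] at h6
  obtain ⟨u, rfl⟩ : ∃ u, t = u + 1 := ⟨t - 1, by omega⟩
  simp only [Nat.add_sub_cancel] at h6
  nlinarith

end Modular

/-! ### Independent generators in exponent one. -/

section Generators

variable {E : Type*} [Field E] {p : ℕ} [Fact p.Prime] [CharP E p]

omit [CharP E p] in
theorem relfinrank_sup_closure_singleton {M : Subfield E} {x : E} {e : ℕ} (hx : x ^ p ^ e ∈ M) :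
    0 < M.relfinrank (M ⊔ Subfield.closure {x}) ∧
      M.relfinrank (M ⊔ Subfield.closure {x}) ≤ p ^ e := by
  have hpe : 0 < p ^ e := pow_pos (Fact.out : p.Prime).pos e
  have hle : M ≤ M ⊔ Subfield.closure {x} := le_sup_left
  rw [Subfield.relfinrank_eq_finrank_of_le hle]
  have heq : Subfield.extendScalars hle = IntermediateField.adjoin M {x} := by
    apply le_antisymm
    · rw [Subfield.extendScalars_le_iff]
      apply sup_le
      · intro y hy
        exact (IntermediateField.adjoin M {x}).algebraMap_mem ⟨y, hy⟩
      · rw [Subfield.closure_le]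
        exact IntermediateField.subset_adjoin M {x}
    · rw [IntermediateField.adjoin_le_iff]
      exact Subfield.subset_closure.trans (le_sup_right : Subfield.closure {x} ≤ _)
  have hroot : Polynomial.aeval x (Polynomial.X ^ p ^ e - Polynomial.C (⟨_, hx⟩ : M)) = 0 := by
    simp only [map_sub, map_pow, Polynomial.aeval_X, Polynomial.aeval_C]
    exact sub_self _
  have hint : IsIntegral M x :=
    ⟨_, Polynomial.monic_X_pow_sub_C _ hpe.ne', hroot⟩
  rw [heq, IntermediateField.adjoin.finrank hint]
  refine ⟨minpoly.natDegree_pos hint, ?_⟩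
  have := Polynomial.natDegree_le_of_dvd (minpoly.dvd M x hroot)
    (Polynomial.monic_X_pow_sub_C _ hpe.ne').ne_zero
  rwa [Polynomial.natDegree_X_pow_sub_C] at this

/-- The degree is a power of p, at most p, and not 1. -/
theorem relfinrank_sup_closure_singleton_eq {M : Subfield E} {x : E} (hx : x ^ p ∈ M)
    (hxM : x ∉ M) : M.relfinrank (M ⊔ Subfield.closure {x}) = p := by
  have h := relfinrank_sup_closure_singleton (p := p) (e := 1) (M := M) (x := x)
    (by rwa [pow_one])
  have hp1 : 1 < p := (Fact.out : p.Prime).one_lt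
  have h1 : M.relfinrank (M ⊔ Subfield.closure {x}) ≠ 1 := by
    rw [Ne, Subfield.relfinrank_eq_one_iff]
    exact fun hle => hxM (hle ((le_sup_right : Subfield.closure {x} ≤ _)
      (Subfield.subset_closure rfl)))
  have h2 : powSubfield p 1 (M ⊔ Subfield.closure {x}) ≤ M := by
    rw [powSubfield_sup]
    refine sup_le (powSubfield_le _ _) ?_
    rw [powSubfield, Subfield.map_le_iff_le_comap, Subfield.closure_le]
    rintro _ rfl
    simpa [iterateFrobenius_def, frobenius_def] using hx
  obtain ⟨n, hn⟩ := exists_relfinrank_eq_pow (p := p) (le_sup_left : M ≤ _) h.1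
    fun y hy => ⟨1, h2 (mem_powSubfield.2 ⟨y, hy, rfl⟩)⟩
  rw [hn] at h h1 ⊢
  have h3 := (Nat.pow_le_pow_iff_right hp1).1 h.2
  have h4 : n ≠ 0 := fun h0 => h1 (by rw [h0, pow_zero])
  rw [show n = 1 by omega, pow_one]

theorem sup_closure_insert (M : Subfield E) (x : E) (s : Set E) :
    M ⊔ Subfield.closure (insert x s) = M ⊔ Subfield.closure s ⊔ Subfield.closure {x} := by
  rw [Set.insert_eq, Subfield.closure_union, sup_comm (Subfield.closure {x}), sup_assoc]

omit [CharP E p] in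
theorem relfinrank_sup_closure_le {M : Subfield E} (s : Finset E) (hs : ∀ x ∈ s, x ^ p ∈ M) :
    0 < M.relfinrank (M ⊔ Subfield.closure s) ∧
      M.relfinrank (M ⊔ Subfield.closure s) ≤ p ^ s.card := by
  classical
  induction s using Finset.induction_on with
  | empty => simp
  | insert a s ha ih =>
    obtain ⟨h1, h2⟩ := ih fun x hx => hs x (Finset.mem_insert_of_mem hx)
    obtain ⟨h3, h4⟩ := relfinrank_sup_closure_singleton (p := p) (e := 1)
      (M := M ⊔ Subfield.closure s) (x := a)
      (by rw [pow_one]; exact (le_sup_left : M ≤ _) (hs a (Finset.mem_insert_self a s)))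
    rw [pow_one] at h4
    rw [Finset.coe_insert, sup_closure_insert, Finset.card_insert_of_notMem ha, pow_succ,
      ← Subfield.relfinrank_mul_relfinrank (le_sup_left : M ≤ M ⊔ Subfield.closure s) le_sup_left]
    exact ⟨Nat.mul_pos h1 h3, Nat.mul_le_mul h2 h4⟩

/-- No element of `B` lies in the field generated over `M` by the others. -/
def IsFieldIndependent (M : Subfield E) (B : Set E) : Prop :=
  ∀ x ∈ B, x ∉ M ⊔ Subfield.closure (B \ {x})

theorem IsFieldIndependent.mono {M : Subfield E} {B C : Set E} (h : IsFieldIndependent M B)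
    (hCB : C ⊆ B) : IsFieldIndependent M C := fun x hx hmem =>
  h x (hCB hx) (sup_le_sup_left (Subfield.closure_mono (Set.sdiff_subset_sdiff_left hCB)) M hmem)

theorem IsFieldIndependent.relfinrank_eq {M : Subfield E} {s : Finset E}
    (h : IsFieldIndependent M (s : Set E)) (hs : ∀ x ∈ s, x ^ p ∈ M) :
    M.relfinrank (M ⊔ Subfield.closure s) = p ^ s.card := by
  classical
  induction s using Finset.induction_on with
  | empty => simp
  | insert a s ha ih =>
    have h1 := ih (h.mono (by simp)) fun x hx => hs x (Finset.mem_insert_of_mem hx)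
    have h2 : a ∉ M ⊔ Subfield.closure s := by
      have := h a (by simp)
      rwa [Finset.coe_insert, Set.insert_sdiff_self_of_notMem (by simpa using ha)] at this
    have h3 := relfinrank_sup_closure_singleton_eq (p := p)
      ((le_sup_left : M ≤ _) (hs a (Finset.mem_insert_self a s))) h2
    rw [Finset.coe_insert, sup_closure_insert, Finset.card_insert_of_notMem ha, pow_succ,
      ← Subfield.relfinrank_mul_relfinrank (le_sup_left : M ≤ M ⊔ Subfield.closure s) le_sup_left,
      h1, h3]

/-- Zorn's lemma gives a maximal independent set; it generates E by the exchange property, valid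
because one-generator extensions here have degree 1 or p. -/
theorem exists_isFieldIndependent {M : Subfield E} (hM : ∀ x : E, x ^ p ∈ M) :
    ∃ B : Set E, IsFieldIndependent M B ∧ M ⊔ Subfield.closure B = ⊤ := by
  have hchain : ∀ c ⊆ {B : Set E | IsFieldIndependent M B}, IsChain (· ⊆ ·) c →
      ∃ ub ∈ {B : Set E | IsFieldIndependent M B}, ∀ s ∈ c, s ⊆ ub := by
    intro c hc hch
    refine ⟨⋃₀ c, ?_, fun s hs => Set.subset_sUnion_of_mem hs⟩
    rintro x ⟨S, hS, hxS⟩ hx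
    have hne : Nonempty c := ⟨⟨S, hS⟩⟩
    have hdir : Directed (· ≤ ·) fun T : c => M ⊔ Subfield.closure ((T : Set E) \ {x}) := by
      intro T U
      rcases hch.total T.2 U.2 with h | h
      · exact ⟨U, sup_le_sup_left (Subfield.closure_mono (Set.sdiff_subset_sdiff_left h)) M, le_rfl⟩
      · exact ⟨T, le_rfl, sup_le_sup_left (Subfield.closure_mono (Set.sdiff_subset_sdiff_left h)) M⟩
    have hle : M ⊔ Subfield.closure (⋃₀ c \ {x}) ≤
        ⨆ T : c, M ⊔ Subfield.closure ((T : Set E) \ {x}) := by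
      refine sup_le (le_iSup_of_le ⟨S, hS⟩ le_sup_left) ?_
      rw [Subfield.closure_le]
      rintro y ⟨⟨T, hT, hyT⟩, hyx⟩
      exact le_iSup (fun T : c => M ⊔ Subfield.closure ((T : Set E) \ {x})) ⟨T, hT⟩
        ((le_sup_right : Subfield.closure _ ≤ _) (Subfield.subset_closure ⟨hyT, hyx⟩))
    obtain ⟨T, hT⟩ := (Subfield.mem_iSup_of_directed hdir).1 (hle hx)
    rcases hch.total hS T.2 with h | h
    · exact hc T.2 x (h hxS) hT
    · exact hc hS x hxS (sup_le_sup_left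
        (Subfield.closure_mono (Set.sdiff_subset_sdiff_left h)) M hT)
  obtain ⟨B, hB⟩ := zorn_subset _ hchain
  refine ⟨B, hB.prop, top_le_iff.1 fun y _ => ?_⟩
  by_contra hy
  refine hy ((le_sup_right : Subfield.closure B ≤ _) (Subfield.subset_closure
    (hB.le_of_ge (y := insert y B) ?_ (Set.subset_insert y B) (Set.mem_insert y B))))
  have hyB : y ∉ B := fun h => hy ((le_sup_right : Subfield.closure B ≤ _)
    (Subfield.subset_closure h))
  rintro x (rfl | hx) hmem
  · rw [Set.insert_sdiff_self_of_notMem hyB] at hmem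
    exact hy hmem
  · have hxy : y ≠ x := fun h => hyB (h ▸ hx)
    rw [Set.insert_sdiff_of_notMem _ (by simpa using hxy), sup_closure_insert] at hmem
    -- Exchange: x lies in N(y), and both N(x) and N(y) have degree p over N, so they coincide and y
    -- already lies in M(B).
    set N := M ⊔ Subfield.closure (B \ {x}) with hN
    have hMN : M ≤ N := le_sup_left
    have hyN : y ∉ N := fun h => hy (sup_le_sup_left (Subfield.closure_mono Set.sdiff_subset) M h)
    have h1 := relfinrank_sup_closure_singleton_eq (p := p) (hMN (hM x)) (hB.prop x hx)
    have h2 := relfinrank_sup_closure_singleton_eq (p := p) (hMN (hM y)) hyN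
    have hle : N ⊔ Subfield.closure {x} ≤ N ⊔ Subfield.closure {y} :=
      sup_le le_sup_left (Subfield.closure_le.2 (by simpa using hmem))
    have h3 := Subfield.relfinrank_mul_relfinrank (le_sup_left : N ≤ N ⊔ Subfield.closure {x}) hle
    rw [h1, h2] at h3
    have h4 : (N ⊔ Subfield.closure {x}).relfinrank (N ⊔ Subfield.closure {y}) = 1 :=
      Nat.eq_of_mul_eq_mul_left (Fact.out : p.Prime).pos (h3.trans (mul_one p).symm)
    rw [Subfield.relfinrank_eq_one_iff] at h4
    have h5 : y ∈ N ⊔ Subfield.closure {x} :=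
      h4 ((le_sup_right : Subfield.closure {y} ≤ _) (Subfield.subset_closure rfl))
    rw [hN, ← sup_closure_insert, Set.insert_sdiff_singleton, Set.insert_eq_of_mem hx] at h5
    exact hy h5

end Generators

/-! ### Cardinality of r-bases as a degree. -/

section RCard

variable {F : Type*} {E : Type*} [Field F] [Field E] [Algebra F E] {p : ℕ}

theorem adjoin_toSubfield (S : Set E) : (IntermediateField.adjoin F S).toSubfield =
    (algebraMap F E).fieldRange ⊔ Subfield.closure S := by
  rw [IntermediateField.adjoin_toSubfield, Subfield.closure_union]
  congr 1
  rw [← RingHom.coe_fieldRange, Subfield.closure_eq]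

theorem adjoin_intermediateField_toSubfield (Q : IntermediateField F E) (S : Set E) :
    (IntermediateField.adjoin Q S).toSubfield = Q.toSubfield ⊔ Subfield.closure S := by
  rw [adjoin_toSubfield]
  congr 1
  ext x
  simp [RingHom.mem_fieldRange]

theorem isMinimalRGenerator_iff (Q : IntermediateField F E) (B : Set E) :
    IsMinimalRGenerator Q E B ↔
      Q.toSubfield ⊔ Subfield.closure B = ⊤ ∧ IsFieldIndependent Q.toSubfield B := by
  refine and_congr ?_ (forall₂_congr fun x _ => not_congr ?_)
  · rw [← adjoin_intermediateField_toSubfield, ← IntermediateField.top_toSubfield (F := Q),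
      IntermediateField.toSubfield_inj]
  · rw [← adjoin_intermediateField_toSubfield]
    rfl

variable [Fact p.Prime] [CharP E p]

theorem powField_toSubfield :
    (powField p F E).toSubfield = powSup p (algebraMap F E).fieldRange 1 ⊤ := by
  rw [powField, adjoin_toSubfield, powSup]
  congr 1
  have : Set.range (fun x : E => x ^ p) = (powSubfield p 1 (⊤ : Subfield E) : Set E) := by
    ext x
    simp [mem_powSubfield]
  rw [this, Subfield.closure_eq]

theorem pow_mem_powSup_one (L : Subfield E) (x : E) : x ^ p ∈ powSup p L 1 ⊤ :=
  (le_sup_right : powSubfield p 1 ⊤ ≤ _) (mem_powSubfield.2 ⟨x, Subfield.mem_top x, by rw [pow_one]⟩)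

theorem isRBasis_iff (B : Set E) : IsRBasis p F E B ↔
    powSup p (algebraMap F E).fieldRange 1 ⊤ ⊔ Subfield.closure B = ⊤ ∧
      IsFieldIndependent (powSup p (algebraMap F E).fieldRange 1 ⊤) B := by
  rw [IsRBasis, isMinimalRGenerator_iff, powField_toSubfield]

-- Since r-bases exist, the infimum defining `rCard` is attained by one. When it is finite with n
-- elements, independence gives [E : F(E^p)] = p^n.
variable (p F E) in
theorem powDegree_eq_of_rCard_lt (h : rCard p F E < Cardinal.aleph0) :
    ∃ n : ℕ, rCard p F E = n ∧ powDegree p (algebraMap F E).fieldRange 0 ⊤ = p ^ n := by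
  obtain ⟨B₀, hB₀⟩ := exists_isFieldIndependent
    (pow_mem_powSup_one (p := p) (algebraMap F E).fieldRange)
  have hne : {c | ∃ B : Set E, IsRBasis p F E B ∧ c = Cardinal.mk B}.Nonempty :=
    ⟨_, B₀, (isRBasis_iff B₀).2 hB₀.symm, rfl⟩
  obtain ⟨B, hB, hc⟩ := csInf_mem hne
  change rCard p F E = _ at hc
  have hfin : B.Finite := Cardinal.lt_aleph0_iff_set_finite.1 (hc ▸ h)
  lift B to Finset E using hfin
  obtain ⟨h1, h2⟩ := (isRBasis_iff _).1 hB
  refine ⟨B.card, hc.trans Cardinal.mk_coe_finset, ?_⟩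
  rw [← h2.relfinrank_eq fun x _ => pow_mem_powSup_one _ x, h1, powDegree, powSup_zero le_top]

theorem rCard_lt_of_powDegree_pos (h : 0 < powDegree p (algebraMap F E).fieldRange 0 ⊤) :
    rCard p F E < Cardinal.aleph0 := by
  obtain ⟨B, hB, htop⟩ := exists_isFieldIndependent
    (pow_mem_powSup_one (p := p) (algebraMap F E).fieldRange)
  rw [powDegree, powSup_zero le_top, zero_add] at h
  have hfin : B.Finite := by
    by_contra hinf
    obtain ⟨s, hs, hcard⟩ := Set.Infinite.exists_subset_card_eq hinf
      ((powSup p (algebraMap F E).fieldRange 1 ⊤).relfinrank ⊤)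
    have h1 := (hB.mono hs).relfinrank_eq (p := p) fun x _ => pow_mem_powSup_one _ x
    have h2 := relfinrank_le_left (le_sup_left : powSup p (algebraMap F E).fieldRange 1 ⊤ ≤
      _ ⊔ Subfield.closure (s : Set E)) le_top h
    rw [h1, hcard] at h2
    exact absurd (Nat.lt_pow_self (Fact.out : p.Prime).one_lt) (not_lt.2 h2)
  refine lt_of_le_of_lt (csInf_le' ⟨B, (isRBasis_iff B).2 ⟨htop, hB⟩, rfl⟩) ?_
  exact Cardinal.lt_aleph0_iff_set_finite.2 hfin

end RCard

/-! ### Canonical sequences and the exponents they compute. -/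

section Exponents

variable {F : Type*} {E : Type*} [Field F] [Field E] [Algebra F E] {p : ℕ} [Fact p.Prime]
  [CharP E p]

/-- `F(a_i : i < j)` for a sequence `a`. -/
noncomputable def initialField (F : Type*) {E : Type*} [Field F] [Field E] [Algebra F E]
    (a : ℕ → E) (j : ℕ) : IntermediateField F E :=
  IntermediateField.adjoin F (a '' Set.Iio j)

omit [Fact p.Prime] [CharP E p] in
theorem initialField_mono (a : ℕ → E) : Monotone (initialField F a) := fun _ _ h =>
  IntermediateField.adjoin.mono F _ _ (Set.image_mono (Set.Iio_subset_Iio h))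

theorem initialField_toSubfield (a : ℕ → E) (j : ℕ) : (initialField F a j).toSubfield =
    (algebraMap F E).fieldRange ⊔ Subfield.closure (a '' Set.Iio j) :=
  adjoin_toSubfield _

theorem initialField_succ (a : ℕ → E) (j : ℕ) : (initialField F a (j + 1)).toSubfield =
    (initialField F a j).toSubfield ⊔ Subfield.closure {a j} := by
  rw [initialField_toSubfield, initialField_toSubfield, ← sup_closure_insert, ← Set.image_insert_eq]
  congr 3
  ext i
  simp only [Set.mem_Iio, Set.mem_insert_iff]
  omega

/-- Every element of the sequence up to `n` has the largest order over the field generated by its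
predecessors. -/
def IsCanonicalSeq (p : ℕ) (F : Type*) {E : Type*} [Field F] [Field E] [Algebra F E]
    (a : ℕ → E) (n : ℕ) : Prop :=
  ∀ j < n, order p (initialField F a j) (a j) = height p (initialField F a j)

omit [Fact p.Prime] [CharP E p] in
theorem before_eq_initialField {n : ℕ} {a : Fin n → E} {b : ℕ → E} (h : ∀ i : Fin n, b i = a i)
    (j : Fin n) : before (F := F) a j = initialField F b j := by
  rw [before, initialField]
  congr 1
  ext x
  constructor
  · rintro ⟨i, hi, rfl⟩
    exact ⟨i, hi, h i⟩
  · rintro ⟨i, hi, rfl⟩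
    exact ⟨⟨i, lt_trans hi j.2⟩, hi, (h _).symm⟩

theorem image_Iio_eq_range {E : Type*} {n : ℕ} {a : Fin n → E} {b : ℕ → E} (h : ∀ i : Fin n, b i = a i) :
    b '' Set.Iio n = Set.range a := by
  ext x
  constructor
  · rintro ⟨i, hi, rfl⟩
    exact ⟨⟨i, hi⟩, (h _).symm⟩
  · rintro ⟨i, rfl⟩
    exact ⟨i, i.2, h i⟩

section Order

variable {R : ℕ} (hR : ∀ x : E, x ^ p ^ R ∈ (algebraMap F E).fieldRange)
include hR

omit [Fact p.Prime] [CharP E p] in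
theorem pow_height_mem (L : IntermediateField F E) (x : E) : x ^ p ^ height p L ∈ L := by
  have hne : {m : ℕ | ∀ x : E, x ^ p ^ m ∈ L}.Nonempty := by
    refine ⟨R, fun x => ?_⟩
    obtain ⟨y, hy⟩ := hR x
    exact hy ▸ L.algebraMap_mem y
  exact Nat.sInf_mem hne x

omit [Fact p.Prime] [CharP E p] in
theorem height_le (L : IntermediateField F E) : height p L ≤ R := by
  refine Nat.sInf_le fun x => ?_
  obtain ⟨y, hy⟩ := hR x
  exact hy ▸ L.algebraMap_mem y

omit [Fact p.Prime] [CharP E p] in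
theorem height_antitone {L M : IntermediateField F E} (h : L ≤ M) : height p M ≤ height p L :=
  Nat.sInf_le fun x => h (pow_height_mem hR L x)

omit [Fact p.Prime] [CharP E p] in
theorem order_le_height (L : IntermediateField F E) (x : E) : order p L x ≤ height p L :=
  Nat.sInf_le (pow_height_mem hR L x)

omit [Fact p.Prime] [CharP E p] in
theorem pow_order_mem (L : IntermediateField F E) (x : E) : x ^ p ^ order p L x ∈ L :=
  Nat.sInf_mem (s := {m : ℕ | x ^ p ^ m ∈ L}) ⟨_, pow_height_mem hR L x⟩

omit [Fact p.Prime] [CharP E p] in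
theorem pow_mem_iff_order_le (L : IntermediateField F E) (x : E) (m : ℕ) :
    x ^ p ^ m ∈ L ↔ order p L x ≤ m := by
  refine ⟨fun h => Nat.sInf_le h, fun h => ?_⟩
  obtain ⟨c, rfl⟩ := Nat.exists_eq_add_of_le h
  rw [pow_add, pow_mul]
  exact pow_mem (pow_order_mem hR L x) _

omit [Fact p.Prime] [CharP E p] in
theorem exists_order_eq_height (L : IntermediateField F E) :
    ∃ x : E, order p L x = height p L := by
  by_contra! hcon
  have hlt : ∀ x, order p L x < height p L := fun x =>
    lt_of_le_of_ne (order_le_height hR L x) (hcon x)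
  have h0 := hlt 0
  have : height p L ≤ height p L - 1 := Nat.sInf_le fun x =>
    (pow_mem_iff_order_le hR L x _).2 (by have := hlt x; omega)
  omega

theorem powSubfield_height_le (L : IntermediateField F E) :
    powSubfield p (height p L) ⊤ ≤ L.toSubfield := by
  intro x hx
  obtain ⟨y, -, rfl⟩ := mem_powSubfield.1 hx
  exact pow_height_mem hR L y

omit [CharP E p] in
theorem relfinrank_initialField_le (a : ℕ → E) (n : ℕ) :
    (algebraMap F E).fieldRange.relfinrank (initialField F a n).toSubfield ≤
      ∏ j ∈ Finset.range n, p ^ order p (initialField F a j) (a j) := by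
  induction n with
  | zero => simp [initialField_toSubfield]
  | succ n ih =>
    have hle : (initialField F a n).toSubfield ≤ (initialField F a (n + 1)).toSubfield :=
      initialField_mono a n.le_succ
    rw [Finset.prod_range_succ, ← Subfield.relfinrank_mul_relfinrank
      (le_sup_left.trans (initialField_toSubfield (F := F) a n).ge) hle]
    refine Nat.mul_le_mul ih ?_
    rw [initialField_succ]
    exact (relfinrank_sup_closure_singleton (pow_order_mem hR _ _)).2

/-- The powers `a_i^(p^r)` are independent as long as `r` is smaller than the orders. -/
theorem pow_le_powDegree_of_lt {a : ℕ → E} {n : ℕ} (ha : IsCanonicalSeq p F a n) {r m : ℕ}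
    (hm : m ≤ n) (hr : ∀ j < m, r < order p (initialField F a j) (a j))
    (hf : 0 < (algebraMap F E).fieldRange.relfinrank ⊤) :
    p ^ m ≤ powDegree p (algebraMap F E).fieldRange r ⊤ := by
  set κ := (algebraMap F E).fieldRange with hκ
  set W := powSup p κ (r + 1) ⊤ with hW
  let V : ℕ → Subfield E := fun j => powSup p W r (initialField F a j).toSubfield
  have hκV : ∀ j, κ ≤ (initialField F a j).toSubfield := fun j =>
    le_sup_left.trans (initialField_toSubfield (F := F) a j).ge
  have hVm : ∀ j, V j ≤ V (j + 1) := fun j => powSup_mono le_rfl r (initialField_mono a j.le_succ)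
  have hVtop : ∀ j, V j ≤ powSup p κ r ⊤ := fun j =>
    sup_le (powSup_antitone κ r.le_succ ⊤)
      ((powSubfield_mono r le_top).trans le_sup_right)
  have hmem : ∀ j, a j ^ p ^ r ∈ V (j + 1) := fun j => by
    refine (le_sup_right : powSubfield p r _ ≤ _) (mem_powSubfield.2 ⟨a j, ?_, rfl⟩)
    rw [initialField_succ]
    exact (le_sup_right : Subfield.closure {a j} ≤ _) (Subfield.subset_closure rfl)
  -- Raising a membership in `V j` to the power p^c, where r + 1 + c is the order of `a j` and also
  -- the height, lands in F(a_i : i < j). Then `a j` would have order at most r + c.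
  have hnot : ∀ j < m, a j ^ p ^ r ∉ V j := by
    intro j hj hjV
    have he := ha j (by omega)
    have hrj := hr j hj
    obtain ⟨c, hc⟩ : ∃ c, order p (initialField F a j) (a j) = r + 1 + c :=
      ⟨_, (Nat.add_sub_of_le hrj).symm⟩
    have h1 : V j ≤ powSup p (initialField F a j).toSubfield (r + 1) ⊤ :=
      sup_le (powSup_mono (hκV j) _ le_rfl) ((powSubfield_le r _).trans le_sup_left)
    have h2 : powSubfield p c (powSup p (initialField F a j).toSubfield (r + 1) ⊤) ≤
        (initialField F a j).toSubfield := by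
      rw [powSup, powSubfield_sup, powSubfield_powSubfield]
      refine sup_le (powSubfield_le c _) ?_
      rw [add_comm, ← hc, he]
      exact powSubfield_height_le hR _
    have h3 : a j ^ p ^ (r + c) ∈ initialField F a j := by
      rw [pow_add, pow_mul]
      exact h2 (mem_powSubfield.2 ⟨_, h1 hjV, rfl⟩)
    rw [pow_mem_iff_order_le hR, hc] at h3
    omega
  have hWκ : 0 < κ.relfinrank W := powSup_relfinrank_pos le_top hf _
  have hWtop : 0 < W.relfinrank ⊤ := relfinrank_pos_right (le_powSup _ _ _) le_top hf
  have key : ∀ j ≤ m, p ^ j ≤ W.relfinrank (V j) := by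
    intro j hj
    induction j with
    | zero => exact relfinrank_pos_left (le_powSup W r _) le_top hWtop
    | succ j ih =>
      have h1 : W ≤ V j := le_powSup W r _
      have hjV : V j ⊔ Subfield.closure {a j ^ p ^ r} ≤ V (j + 1) :=
        sup_le (hVm j) (Subfield.closure_le.2 (by simpa using hmem j))
      have hpow : (a j ^ p ^ r) ^ p ∈ V j := by
        rw [← pow_mul, ← pow_succ]
        exact h1 ((le_sup_right : powSubfield p (r + 1) ⊤ ≤ _)
          (mem_powSubfield.2 ⟨a j, Subfield.mem_top _, rfl⟩))
      have h2 := relfinrank_sup_closure_singleton_eq hpow (hnot j (by omega))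
      rw [← Subfield.relfinrank_mul_relfinrank h1 (hVm j), pow_succ]
      refine Nat.mul_le_mul (ih (by omega)) ?_
      rw [← h2]
      exact relfinrank_le_left le_sup_left hjV (relfinrank_pos_left (hVm j) le_top
        (relfinrank_pos_right h1 le_top hWtop))
  exact (key m le_rfl).trans (relfinrank_le_left (le_powSup W r _) (hVtop m)
    (relfinrank_pos_left (powSup_antitone κ r.le_succ ⊤) le_top hWtop))

omit [Fact p.Prime] [CharP E p] in
theorem order_antitone {a : ℕ → E} {n : ℕ} (ha : IsCanonicalSeq p F a n) {i j : ℕ} (hij : i ≤ j)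
    (hj : j < n) :
    order p (initialField F a j) (a j) ≤ order p (initialField F a i) (a i) := by
  rw [ha j hj, ha i (by omega)]
  exact height_antitone hR (initialField_mono a hij)

/-- Each step degree is at least the right-hand side. The product of all step degrees is [E : F],
which is at most p to the sum of the orders, the product of the right-hand sides. So every
inequality is an equality. -/
theorem powDegree_eq_pow_card {a : ℕ → E} {n : ℕ} (ha : IsCanonicalSeq p F a n)
    (htop : initialField F a n = ⊤) (hf : 0 < (algebraMap F E).fieldRange.relfinrank ⊤) (r : ℕ) :
    powDegree p (algebraMap F E).fieldRange r ⊤ =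
      p ^ ((Finset.range n).filter fun j => r < order p (initialField F a j) (a j)).card := by
  set κ := (algebraMap F E).fieldRange with hκ
  set e : ℕ → ℕ := fun j => order p (initialField F a j) (a j) with he
  have hpp : 0 < p := (Fact.out : p.Prime).pos
  have hRtop : powSubfield p R ⊤ ≤ κ := by
    intro x hx
    obtain ⟨y, -, rfl⟩ := mem_powSubfield.1 hx
    exact hR y
  have heR : ∀ j, e j ≤ R := fun j => (order_le_height hR _ _).trans (height_le hR _)
  have hlow : ∀ r, p ^ ((Finset.range n).filter fun j => r < e j).card ≤ powDegree p κ r ⊤ := by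
    intro r
    refine pow_le_powDegree_of_lt hR ha
      ((Finset.card_filter_le _ _).trans (Finset.card_range n).le) ?_ hf
    intro j hj
    by_contra! hle
    -- The orders decrease along the sequence, so the indices with order above r form an initial
    -- segment.
    have hsub : (Finset.range n).filter (fun j => r < e j) ⊆ Finset.range j := by
      intro i hi
      rw [Finset.mem_filter, Finset.mem_range] at hi
      rw [Finset.mem_range]
      by_contra! hji
      have := order_antitone hR ha hji hi.1
      have h2 := hi.2
      simp only [he] at h2
      omega
    have := Finset.card_le_card hsub
    rw [Finset.card_range] at this
    omega
  rcases lt_or_ge r R with hr | hr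
  · have hprod : ∏ r ∈ Finset.range R, powDegree p κ r ⊤ ≤
        ∏ r ∈ Finset.range R, p ^ ((Finset.range n).filter fun j => r < e j).card := by
      have h1 := relfinrank_powSup_eq_prod (p := p) κ 0 R ⊤
      rw [zero_add, powSup_eq_of_powSubfield_le hRtop, powSup_zero le_top] at h1
      simp only [zero_add] at h1
      rw [← h1]
      have h2 := relfinrank_initialField_le hR a n
      rw [htop, IntermediateField.top_toSubfield] at h2
      refine h2.trans (le_of_eq ?_)
      rw [Finset.prod_pow_eq_pow_sum, Finset.prod_pow_eq_pow_sum]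
      congr 1
      simp only [Finset.card_filter]
      rw [Finset.sum_comm]
      refine Finset.sum_congr rfl fun j _ => ?_
      rw [← Finset.card_filter]
      have : (Finset.range R).filter (fun r => r < e j) = Finset.range (e j) := by
        ext i
        have := heR j
        simp only [Finset.mem_filter, Finset.mem_range]
        omega
      rw [this, Finset.card_range]
    by_contra hne
    have hlt := lt_of_le_of_ne (hlow r) (Ne.symm hne)
    exact absurd hprod (not_le.2 (Finset.prod_lt_prod (fun i _ => pow_pos hpp _)
      (fun i _ => hlow i) ⟨r, Finset.mem_range.2 hr, hlt⟩))
  · have h1 : (Finset.range n).filter (fun j => r < e j) = ∅ :=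
      Finset.filter_eq_empty_iff.2 fun j _ => by have := heR j; omega
    rw [h1, Finset.card_empty, pow_zero, powDegree, Subfield.relfinrank_eq_one_iff,
      powSup_eq_of_powSubfield_le ((powSubfield_antitone hr ⊤).trans hRtop)]
    exact le_powSup _ _ _

theorem lt_iff_pow_le_powDegree {a : ℕ → E} {n : ℕ} (ha : IsCanonicalSeq p F a n)
    (htop : initialField F a n = ⊤) (hf : 0 < (algebraMap F E).fieldRange.relfinrank ⊤) (r s : ℕ) :
    (s < n ∧ r < order p (initialField F a s) (a s)) ↔
      p ^ (s + 1) ≤ powDegree p (algebraMap F E).fieldRange r ⊤ := by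
  rw [powDegree_eq_pow_card hR ha htop hf,
    Nat.pow_le_pow_iff_right (Fact.out : p.Prime).one_lt]
  constructor
  · rintro ⟨hs, hr⟩
    have hsub : Finset.range (s + 1) ⊆
        (Finset.range n).filter fun j => r < order p (initialField F a j) (a j) := by
      intro i hi
      rw [Finset.mem_range] at hi
      rw [Finset.mem_filter, Finset.mem_range]
      exact ⟨by omega, hr.trans_le (order_antitone hR ha (by omega) hs)⟩
    simpa using Finset.card_le_card hsub
  · intro h
    by_contra hcon
    have hsub : (Finset.range n).filter (fun j => r < order p (initialField F a j) (a j)) ⊆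
        Finset.range s := by
      intro i hi
      rw [Finset.mem_filter, Finset.mem_range] at hi
      rw [Finset.mem_range]
      by_contra! hsi
      exact hcon ⟨by omega, hi.2.trans_le (order_antitone hR ha hsi hi.1)⟩
    have := Finset.card_le_card hsub
    rw [Finset.card_range] at this
    omega

/-- A Nakayama argument: iterating gives T(E^(p^R)) = E, while E^(p^R) lies in T. It turns
generation over F(E^p) into generation over F. -/
theorem eq_top_of_powSup_eq_top {T : Subfield E} (hT : (algebraMap F E).fieldRange ≤ T)
    (h : powSup p T 1 ⊤ = ⊤) : T = ⊤ := by
  rw [← powSup_eq_self h le_top R]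
  symm
  refine powSup_eq_of_powSubfield_le fun x hx => ?_
  obtain ⟨y, -, rfl⟩ := mem_powSubfield.1 hx
  exact hT (hR y)

/-- Greedy choice: a sequence with positive orders has bounded length, since p^n ≤ [E : F(E^p)]. One
of maximal length generates E, otherwise an element of largest order could be appended. -/
theorem exists_isCanonicalSeq (hf : 0 < (algebraMap F E).fieldRange.relfinrank ⊤) :
    ∃ (n : ℕ) (a : ℕ → E), IsCanonicalSeq p F a n ∧
      (∀ j < n, 0 < order p (initialField F a j) (a j)) ∧ initialField F a n = ⊤ := by
  let S : Set ℕ := {n | ∃ a : ℕ → E, IsCanonicalSeq p F a n ∧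
    ∀ j < n, 0 < order p (initialField F a j) (a j)}
  have hbd : BddAbove S := by
    refine ⟨powDegree p (algebraMap F E).fieldRange 0 ⊤, ?_⟩
    rintro n ⟨a, ha, hpos⟩
    exact (Nat.lt_pow_self (Fact.out : p.Prime).one_lt).le.trans
      (pow_le_powDegree_of_lt hR ha le_rfl hpos hf)
  have hne : S.Nonempty := ⟨0, fun _ => 0, fun j hj => absurd hj j.not_lt_zero,
    fun j hj => absurd hj j.not_lt_zero⟩
  obtain ⟨a, ha, hpos⟩ := Nat.sSup_mem hne hbd
  set n := sSup S with hn
  refine ⟨n, a, ha, hpos, ?_⟩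
  by_contra htop
  obtain ⟨x, hx⟩ := exists_order_eq_height hR (initialField F a n)
  let b := Function.update a n x
  have hb : ∀ j ≤ n, initialField F b j = initialField F a j := by
    intro j hj
    rw [initialField, initialField]
    congr 1
    refine Set.image_congr fun i hi => Function.update_of_ne ?_ _ _
    have := Set.mem_Iio.1 hi
    omega
  have hbj : ∀ j < n, b j = a j := fun j hj => Function.update_of_ne (by omega) _ _
  have hbn : b n = x := Function.update_self _ _ _
  have hmem : n + 1 ∈ S := by
    refine ⟨b, fun j hj => ?_, fun j hj => ?_⟩
    · rw [hb j (by omega)]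
      rcases Nat.lt_succ_iff_lt_or_eq.1 hj with h | rfl
      · rw [hbj j h]; exact ha j h
      · rw [hbn]; exact hx
    · rw [hb j (by omega)]
      rcases Nat.lt_succ_iff_lt_or_eq.1 hj with h | rfl
      · rw [hbj j h]; exact hpos j h
      · rw [hbn, hx, Nat.pos_iff_ne_zero]
        intro h0
        refine htop (top_le_iff.1 fun y _ => ?_)
        have := pow_height_mem hR (initialField F a (sSup S)) y
        rwa [h0, pow_zero, pow_one] at this
  have := le_csSup hbd hmem
  omega

theorem isCanonicalRBasis_of_isCanonicalSeq {a : ℕ → E} {n : ℕ} (ha : IsCanonicalSeq p F a n)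
    (hpos : ∀ j < n, 0 < order p (initialField F a j) (a j)) (htop : initialField F a n = ⊤)
    (hf : 0 < (algebraMap F E).fieldRange.relfinrank ⊤) :
    IsCanonicalRBasis p F E fun i : Fin n => a i := by
  have hnot : ∀ j < n, a j ∉ initialField F a j := by
    intro j hj hmem
    have := (pow_mem_iff_order_le hR (initialField F a j) (a j) 0).1 (by simpa using hmem)
    have := hpos j hj
    omega
  have hlt : ∀ i j : Fin n, i < j → a i ≠ a j := fun i j hij h =>
    hnot j j.2 (h ▸ IntermediateField.subset_adjoin F _ ⟨i, hij, rfl⟩)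
  have hinj : Function.Injective fun i : Fin n => a i := by
    intro i j hij
    by_contra hne
    rcases lt_or_gt_of_ne hne with h | h
    · exact hlt i j h hij
    · exact hlt j i h hij.symm
  have hgen : powSup p (algebraMap F E).fieldRange 1 ⊤ ⊔
      Subfield.closure (Set.range fun i : Fin n => a i) = ⊤ := by
    have h1 := initialField_toSubfield (F := F) a n
    rw [htop, IntermediateField.top_toSubfield,
      image_Iio_eq_range (a := fun i : Fin n => a i) fun _ => rfl] at h1
    exact top_le_iff.1 (h1.le.trans (sup_le_sup_right (le_powSup _ _ _) _))
  refine ⟨hinj, (isRBasis_iff _).2 ⟨hgen, ?_⟩, fun j => ?_⟩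
  · rintro _ ⟨j, rfl⟩ hmem
    classical
    let s : Finset E := (Finset.univ.image fun i : Fin n => a i).erase (a j)
    have hs : (s : Set E) = Set.range (fun i : Fin n => a i) \ {a j} := by
      simp [s]
    have hcard : s.card = n - 1 := by
      rw [Finset.card_erase_of_mem (Finset.mem_image_of_mem _ (Finset.mem_univ j)),
        Finset.card_image_of_injective _ hinj, Finset.card_univ, Fintype.card_fin]
    have h1 := (relfinrank_sup_closure_le (p := p) s
      fun x _ => pow_mem_powSup_one (algebraMap F E).fieldRange x).2
    have h2 : powSup p (algebraMap F E).fieldRange 1 ⊤ ⊔ Subfield.closure (s : Set E) = ⊤ := by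
      rw [hs]
      refine top_le_iff.1 (hgen.ge.trans (sup_le le_sup_left (Subfield.closure_le.2 ?_)))
      intro x hx
      by_cases hxj : x = a j
      · rw [hxj]
        exact hmem
      · exact (le_sup_right : Subfield.closure (Set.range (fun i : Fin n => a i) \ {a j}) ≤ _)
          (Subfield.subset_closure ⟨hx, hxj⟩)
    -- A redundant generator would give [E : F(E^p)] ≤ p^(n-1), against the lower bound p^n.
    have h3 := pow_le_powDegree_of_lt hR ha le_rfl hpos hf
    rw [powDegree, powSup_zero le_top] at h3
    rw [h2, hcard] at h1
    have := (Nat.pow_le_pow_iff_right (Fact.out : p.Prime).one_lt).1 (h3.trans h1)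
    have := j.2
    omega
  · rw [before_eq_initialField (b := a) (fun _ => rfl) j]
    exact ha j j.2

/-- The defining set is nonempty, so the exponent comes from an actual canonically ordered r-basis,
and step degrees do not depend on which one. The exponents are numbered from 1 and the sequence from
0, hence `s + 1`. -/
theorem lt_exponent_iff (hf : 0 < (algebraMap F E).fieldRange.relfinrank ⊤) (r s : ℕ) :
    r < exponent p F E (s + 1) ↔
      p ^ (s + 1) ≤ powDegree p (algebraMap F E).fieldRange r ⊤ := by
  obtain ⟨n₀, a₀, ha₀, hpos₀, htop₀⟩ := exists_isCanonicalSeq hR hf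
  have hcan := isCanonicalRBasis_of_isCanonicalSeq hR ha₀ hpos₀ htop₀ hf
  have hne : {e : ℕ | ∃ (n : ℕ) (a : Fin n → E), IsCanonicalRBasis p F E a ∧
    ((∃ j : Fin n, (j : ℕ) + 1 = s + 1 ∧ e = order p (before (F := F) a j) (a j)) ∨
      (n < s + 1 ∧ e = 0))}.Nonempty := by
    rcases lt_or_ge s n₀ with h | h
    · exact ⟨_, n₀, _, hcan, Or.inl ⟨⟨s, h⟩, rfl, rfl⟩⟩
    · exact ⟨_, n₀, _, hcan, Or.inr ⟨by omega, rfl⟩⟩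
  obtain ⟨n, a, ⟨-, hbasis, hord⟩, hval⟩ := Nat.sInf_mem hne
  change (∃ j : Fin n, _ ∧ exponent p F E (s + 1) = _) ∨ _ ∧ exponent p F E (s + 1) = 0 at hval
  let b : ℕ → E := fun i => if h : i < n then a ⟨i, h⟩ else 0
  have hb : ∀ i : Fin n, b i = a i := fun i => by simp [b]
  have hbseq : IsCanonicalSeq p F b n := fun j hj => by
    have := hord ⟨j, hj⟩
    rwa [before_eq_initialField hb, ← hb] at this
  have hbtop : initialField F b n = ⊤ := by
    apply IntermediateField.toSubfield_injective
    rw [IntermediateField.top_toSubfield]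
    refine eq_top_of_powSup_eq_top hR
      (le_sup_left.trans (initialField_toSubfield (F := F) b n).ge) ?_
    rw [initialField_toSubfield, image_Iio_eq_range hb]
    refine top_le_iff.1 (((isRBasis_iff _).1 hbasis).1.ge.trans ?_)
    exact sup_le (powSup_mono le_sup_left 1 le_rfl) (le_sup_right.trans le_sup_left)
  rw [← lt_iff_pow_le_powDegree hR hbseq hbtop hf]
  rcases hval with ⟨j, hj, he⟩ | ⟨hns, he⟩
  · have hjs : (j : ℕ) = s := by omega
    rw [he, before_eq_initialField hb, ← hb, hjs]
    exact (and_iff_right (hjs ▸ j.2)).symm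
  · rw [he]
    constructor
    · intro h; omega
    · rintro ⟨h, -⟩; omega

end Order

end Exponents

/-! ### Translation of the definitions into subfields of K. -/

section Transfer

variable {p : ℕ} [Fact p.Prime]

theorem map_powSup {E K : Type*} [Field E] [Field K] [CharP E p] [CharP K p] (f : E →+* K)
    (L : Subfield E) (r : ℕ) (A : Subfield E) :
    (powSup p L r A).map f = powSup p (L.map f) r (A.map f) := by
  rw [powSup, powSup, Subfield.map_sup]
  congr 1
  ext x
  simp only [Subfield.mem_map, mem_powSubfield]
  constructor
  · rintro ⟨_, ⟨y, hy, rfl⟩, rfl⟩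
    exact ⟨f y, ⟨y, hy, rfl⟩, (map_pow f y _).symm⟩
  · rintro ⟨_, ⟨y, hy, rfl⟩, rfl⟩
    exact ⟨_, ⟨y, hy, rfl⟩, map_pow f y _⟩

variable {k K : Type*} [Field k] [Field K] [Algebra k K]

theorem map_fieldRange_algebraMap {E : Type*} [Field E] [Algebra k E] (f : E →ₐ[k] K) :
    (algebraMap k E).fieldRange.map (f : E →+* K) = (algebraMap k K).fieldRange := by
  rw [RingHom.map_fieldRange, AlgHom.comp_algebraMap]

theorem map_top_eq_fieldRange {E : Type*} [Field E] [Algebra k E] (f : E →ₐ[k] K) :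
    (⊤ : Subfield E).map (f : E →+* K) = f.fieldRange.toSubfield := by
  ext x
  simp [Subfield.mem_map]

theorem relfinrank_fieldRange_top {E : Type*} [Field E] [Algebra k E] (f : E →ₐ[k] K) :
    (algebraMap k E).fieldRange.relfinrank ⊤ =
      (algebraMap k K).fieldRange.relfinrank f.fieldRange.toSubfield := by
  rw [← map_fieldRange_algebraMap f, ← map_top_eq_fieldRange f, Subfield.relfinrank_map_map]

theorem powDegree_fieldRange_top [CharP K p] {E : Type*} [Field E] [Algebra k E] [CharP E p]
    (f : E →ₐ[k] K) (r : ℕ) :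
    powDegree p (algebraMap k E).fieldRange r ⊤ =
      powDegree p (algebraMap k K).fieldRange r f.fieldRange.toSubfield := by
  rw [powDegree, powDegree, ← map_fieldRange_algebraMap f, ← map_top_eq_fieldRange f,
    ← map_powSup, ← map_powSup, Subfield.relfinrank_map_map]

theorem finiteDimensional_iff_relfinrank_pos (L : IntermediateField k K) :
    FiniteDimensional k L ↔ 0 < (algebraMap k K).fieldRange.relfinrank L.toSubfield := by
  have h := IntermediateField.relfinrank_bot_left L
  rw [IntermediateField.relfinrank, IntermediateField.bot_toSubfield] at h
  rw [h]
  exact ⟨fun _ => Module.finrank_pos, FiniteDimensional.of_finrank_pos⟩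

variable [CharP K p]

theorem isRelativelyPerfect_iff (L : IntermediateField k K) :
    IsRelativelyPerfect p k L ↔
      powSup p (algebraMap k K).fieldRange 1 L.toSubfield = L.toSubfield := by
  have : CharP L p := (algebraMap L K).charP (algebraMap L K).injective p
  have hL : (⊤ : Subfield L).map (L.val : L →+* K) = L.toSubfield := by
    rw [map_top_eq_fieldRange, IntermediateField.fieldRange_val]
  have hinj : Function.Injective (Subfield.map (L.val : L →+* K)) :=
    fun A B h => SetLike.coe_injective (L.val.injective.image_injective
      (by simpa using! congrArg ((↑) : Subfield K → Set K) h))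
  rw [IsRelativelyPerfect, ← IntermediateField.toSubfield_inj, powField_toSubfield,
    IntermediateField.top_toSubfield, ← hinj.eq_iff, map_powSup, map_fieldRange_algebraMap, hL]

/-- A relatively perfect L satisfies L = κ(L^(p^J)), so it lies in κ(K^(p^J)), which is itself
relatively perfect by hypothesis. -/
theorem rp_toSubfield {J : ℕ}
    (h : powSup p (algebraMap k K).fieldRange 1 (powSup p (algebraMap k K).fieldRange J ⊤) =
      powSup p (algebraMap k K).fieldRange J ⊤) :
    (rp p k K).toSubfield = powSup p (algebraMap k K).fieldRange J ⊤ := by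
  let P : IntermediateField k K := (powSup p (algebraMap k K).fieldRange J ⊤).toIntermediateField
    fun x => le_powSup _ _ _ ⟨x, rfl⟩
  have hP : P.toSubfield = powSup p (algebraMap k K).fieldRange J ⊤ := rfl
  apply le_antisymm
  · rw [← hP]
    refine (sSup_le fun L hL => ?_ : rp p k K ≤ P)
    have h1 := powSup_eq_self ((isRelativelyPerfect_iff L).1 hL)
      (fun _ ⟨x, hx⟩ => hx ▸ L.algebraMap_mem x) J
    change L.toSubfield ≤ P.toSubfield
    rw [← h1]
    exact powSup_mono le_rfl J le_top
  · rw [← hP]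
    refine (le_sSup ?_ : P ≤ rp p k K)
    exact (isRelativelyPerfect_iff P).2 h

theorem rCard_eq_of_lt {E : Type*} [Field E] [Algebra k E] (f : E →ₐ[k] K)
    (h : rCard p k E < Cardinal.aleph0) : ∃ n : ℕ, rCard p k E = n ∧
      powDegree p (algebraMap k K).fieldRange 0 f.fieldRange.toSubfield = p ^ n := by
  have : CharP E p := (f : E →+* K).charP (f : E →+* K).injective p
  rw [← powDegree_fieldRange_top]
  exact powDegree_eq_of_rCard_lt k E p h

theorem rCard_lt_of_fieldRange {E : Type*} [Field E] [Algebra k E] (f : E →ₐ[k] K)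
    (h : 0 < powDegree p (algebraMap k K).fieldRange 0 f.fieldRange.toSubfield) :
    rCard p k E < Cardinal.aleph0 := by
  have : CharP E p := (f : E →+* K).charP (f : E →+* K).injective p
  rw [← powDegree_fieldRange_top] at h
  exact rCard_lt_of_powDegree_pos h

/-- Finiteness of the first step passes to all later ones by Frobenius, and [A : L] is the product
of the first n steps. -/
theorem relfinrank_pos_of_powDegree_pos {L A : Subfield K} (hL : L ≤ A) {n : ℕ}
    (hn : powSubfield p n A ≤ L) (h : 0 < powDegree p L 0 A) : 0 < L.relfinrank A := by
  have hpos : ∀ r, 0 < powDegree p L r A := by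
    intro r
    induction r with
    | zero => exact h
    | succ r ih =>
      have := relfinrank_powSup_powSup_le (powSup_antitone (p := p) L r.le_succ A) ih L (p := p) 1
      rw [← powSup_succ, ← powSup_succ] at this
      exact this.1
  have h1 := relfinrank_powSup_eq_prod (p := p) L 0 n A
  rw [zero_add, powSup_eq_of_powSubfield_le hn, powSup_zero hL] at h1
  rw [h1]
  exact Finset.prod_pos fun r _ => hpos _

theorem HasLargeExponents.mono {κ : Subfield K} {s t : ℕ} (h : HasLargeExponents p κ t)
    (hst : s ≤ t) : HasLargeExponents p κ s := by
  obtain ⟨C, hC⟩ := h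
  exact ⟨C, fun j r hj =>
    (Nat.pow_le_pow_right (Fact.out : p.Prime).pos hst).trans (hC j r hj)⟩

theorem isModularOver_iff [CharP k p] (L : IntermediateField k K) : IsModularOver p L ↔
    ∀ n, LinDisjointOverInf (powSubfield p n ⊤) L.toSubfield := by
  refine forall_congr' fun n => ?_
  rw [powSubfield, ← RingHom.fieldRange_eq_map]

variable [CharP k p]

theorem level_toSubfield (n : ℕ) :
    (level p k K n).toSubfield = rootSubfield p (algebraMap k K).fieldRange n := rfl

theorem boundedU_succ_iff
    (hfin : ∀ n, 0 < (algebraMap k K).fieldRange.relfinrank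
      (rootSubfield p (algebraMap k K).fieldRange n)) (s : ℕ) :
    BoundedU p k K (s + 1) ↔ HasLargeExponents p (algebraMap k K).fieldRange (s + 1) := by
  have hexp : ∀ j r, r < exponent p k (level p k K j) (s + 1) ↔
      p ^ (s + 1) ≤ powDegree p (algebraMap k K).fieldRange r
        (rootSubfield p (algebraMap k K).fieldRange j) := by
    intro j r
    have : CharP (level p k K j) p := (algebraMap (level p k K j) K).charP
      (algebraMap (level p k K j) K).injective p
    have hf := relfinrank_fieldRange_top (level p k K j).val
    have hd := powDegree_fieldRange_top (p := p) (level p k K j).val r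
    rw [IntermediateField.fieldRange_val, level_toSubfield] at hf hd
    rw [← hd]
    refine lt_exponent_iff (R := j) ?_ (hf ▸ hfin j) r s
    rintro ⟨x, hx⟩
    obtain ⟨y, hy⟩ := (mem_level p _ _).1 hx
    exact ⟨y, Subtype.ext hy⟩
  have hle : ∀ j, exponent p k (level p k K j) (s + 1) ≤ j := by
    intro j
    by_contra! h
    have h1 := (hexp j j).1 h
    rw [powDegree, powSup_eq_of_powSubfield_le (powSubfield_rootSubfield_le _ j),
      powSup_eq_of_powSubfield_le ((powSubfield_antitone j.le_succ _).trans
        (powSubfield_rootSubfield_le _ j)), Subfield.relfinrank_self] at h1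
    exact absurd (Nat.one_lt_pow s.succ_ne_zero (Fact.out : p.Prime).one_lt) (not_lt.2 h1)
  constructor
  · rintro ⟨C, hC⟩
    refine ⟨C.toNat, fun j r hr => (hexp j r).1 ?_⟩
    have := (abs_le.1 (hC j)).2
    rw [U] at this
    omega
  · rintro ⟨C, hC⟩
    refine ⟨C, fun j => ?_⟩
    have h1 := hle j
    rw [U, abs_le]
    refine ⟨by omega, ?_⟩
    by_contra! h
    have h2 := (hexp j (j - C - 1)).2 (hC j (j - C - 1) (by omega))
    omega

theorem exists_forall_powDegree_le_of_isQFinite (hq : IsQFinite p k K) :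
    ∃ d, ∀ n, 0 < powDegree p (algebraMap k K).fieldRange 0
        (rootSubfield p (algebraMap k K).fieldRange n) ∧
      powDegree p (algebraMap k K).fieldRange 0
        (rootSubfield p (algebraMap k K).fieldRange n) ≤ p ^ d := by
  have hpp : 0 < p := (Fact.out : p.Prime).pos
  obtain ⟨d, hd⟩ := Cardinal.lt_aleph0.1 hq
  refine ⟨d, fun n => ?_⟩
  cases n with
  | zero =>
    have h0 : rootSubfield p (algebraMap k K).fieldRange 0 = (algebraMap k K).fieldRange := by
      ext x
      rw [mem_rootSubfield, pow_zero, pow_one]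
    rw [h0, powDegree, powSup_zero le_rfl, powSup_eq_of_powSubfield_le (powSubfield_le _ _),
      Subfield.relfinrank_self]
    exact ⟨one_pos, Nat.one_le_pow _ _ hpp⟩
  | succ n =>
    have hle : rCard p k (level p k K (n + 1)) ≤ d :=
      hd ▸ le_ciSup (f := fun n => rCard p k (level p k K (n + 1)))
        Cardinal.bddAbove_of_small n
    obtain ⟨m, hm, hm'⟩ := rCard_eq_of_lt (level p k K (n + 1)).val
      (hle.trans_lt (Cardinal.natCast_lt_aleph0))
    rw [IntermediateField.fieldRange_val, level_toSubfield] at hm'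
    rw [hm']
    rw [hm] at hle
    exact ⟨pow_pos hpp _, Nat.pow_le_pow_right hpp (by exact_mod_cast hle)⟩

/-- The irrationality degree of an intermediate field of a `q`-finite extension. -/
theorem exists_di_eq (P : IntermediateField k K)
    (hfin : ∀ n, 0 < (algebraMap k K).fieldRange.relfinrank
      (rootSubfield p (algebraMap k K).fieldRange n)) {d : ℕ}
    (hd : ∀ n, powDegree p (algebraMap k K).fieldRange 0
      (rootSubfield p (algebraMap k K).fieldRange n) ≤ p ^ d) :
    ∃ t : ℕ, di p k P = t ∧
      (∀ n, powDegree p (algebraMap k K).fieldRange 0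
        (P.toSubfield ⊓ rootSubfield p (algebraMap k K).fieldRange n) ≤ p ^ t) ∧
      ∃ n, p ^ t ≤ powDegree p (algebraMap k K).fieldRange 0
        (P.toSubfield ⊓ rootSubfield p (algebraMap k K).fieldRange n) := by
  set κ := (algebraMap k K).fieldRange with hκ
  have hp1 : 1 < p := (Fact.out : p.Prime).one_lt
  have hκP : κ ≤ P.toSubfield := fun _ ⟨x, hx⟩ => hx ▸ P.algebraMap_mem x
  have hPf := inf_rootSubfield_relfinrank_pos (p := p) hκP hfin
  have hκPn : ∀ n, κ ≤ P.toSubfield ⊓ rootSubfield p κ n := fun n =>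
    le_inf hκP (le_rootSubfield κ n)
  have hrange : ∀ n, (P.val.comp (level p k P n).val).fieldRange.toSubfield =
      P.toSubfield ⊓ rootSubfield p κ n := by
    intro n
    ext x
    constructor
    · rintro ⟨y, rfl⟩
      refine ⟨y.1.2, mem_rootSubfield.2 ?_⟩
      obtain ⟨z, hz⟩ := (mem_level p _ _).1 y.2
      exact ⟨z, congrArg P.val hz⟩
    · rintro ⟨hx, hx'⟩
      obtain ⟨z, hz⟩ := mem_rootSubfield.1 hx'
      exact ⟨⟨⟨x, hx⟩, (mem_level p _ _).2 ⟨z, Subtype.ext hz⟩⟩, rfl⟩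
  have hr : ∀ n, ∃ m : ℕ, rCard p k (level p k P (n + 1)) = m ∧
      powDegree p κ 0 (P.toSubfield ⊓ rootSubfield p κ (n + 1)) = p ^ m := by
    intro n
    rw [← hrange]
    refine rCard_eq_of_lt _ (rCard_lt_of_fieldRange (K := K)
      (P.val.comp (level p k P (n + 1)).val) ?_)
    rw [hrange]
    exact powDegree_pos (hκPn _) (hPf _) 0
  choose m hm hm' using hr
  have hbd : BddAbove (Set.range m) := by
    refine ⟨d, ?_⟩
    rintro _ ⟨n, rfl⟩
    rw [← Nat.pow_le_pow_iff_right hp1, ← hm']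
    exact (powDegree_zero_mono (hκPn _) inf_le_right (hfin _)).trans (hd _)
  obtain ⟨n₀, hn₀⟩ := Nat.sSup_mem (Set.range_nonempty m) hbd
  have hmt : ∀ n, m n ≤ m n₀ := fun n => hn₀ ▸ le_csSup hbd ⟨n, rfl⟩
  refine ⟨m n₀, le_antisymm (ciSup_le' fun n => ?_) ?_, fun n => ?_, n₀ + 1, (hm' n₀).ge⟩
  · rw [hm]
    exact_mod_cast hmt n
  · rw [← hm]
    exact le_ciSup (f := fun n => rCard p k (level p k P (n + 1))) Cardinal.bddAbove_of_small n₀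
  -- The supremum defining `di` starts at level 1, so level n is bounded by level n + 1; this covers
  -- n = 0.
  · refine (powDegree_zero_mono (hκPn n) (inf_le_inf_left _
      (monotone_rootSubfield κ n.le_succ)) (hPf _)).trans ?_
    rw [Nat.succ_eq_add_one, hm']
    exact Nat.pow_le_pow_right hp1.le (hmt n)

end Transfer

end PurelyInsep

/-! ### The main theorem. -/

open PurelyInsep

theorem mainTheorem6 {p : ℕ} [Fact p.Prime] {k : Type*} {K : Type*} [Field k] [Field K]
    [Algebra k K] [CharP k p] [IsPurelyInseparable k K] (hq : PurelyInsep.IsQFinite p k K) :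
    ∃ t : ℕ, PurelyInsep.di p k (PurelyInsep.rp p k K) = (t : Cardinal) ∧
      List.TFAE [
        ∃ L : IntermediateField k K, FiniteDimensional k L ∧ PurelyInsep.IsModularOver p L,
        ∀ s : ℕ, 1 ≤ s → s ≤ t → PurelyInsep.BoundedU p k K s,
        PurelyInsep.Ilqm p k K = t + 1] := by
  have : CharP K p := charP_of_injective_algebraMap (algebraMap k K).injective p
  set κ := (algebraMap k K).fieldRange with hκ
  have hp : ∀ x : K, ∃ n : ℕ, x ^ p ^ n ∈ κ := fun x =>
    IsPurelyInseparable.pow_mem k p x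
  obtain ⟨d, hd⟩ := exists_forall_powDegree_le_of_isQFinite hq
  have hfin : ∀ n, 0 < κ.relfinrank (rootSubfield p κ n) := fun n =>
    relfinrank_pos_of_powDegree_pos (le_rootSubfield κ n) (powSubfield_rootSubfield_le κ n) (hd n).1
  obtain ⟨J, hJ⟩ := exists_powSup_sup_rootSubfield_eq_top hp hfin fun n => (hd n).2
  have hrp := rp_toSubfield (powSup_succ_top_eq hJ)
  have h1 : powSup p κ 1 (rp p k K).toSubfield = (rp p k K).toSubfield := by
    rw [hrp]
    exact powSup_succ_top_eq hJ
  have hκP : κ ≤ (rp p k K).toSubfield := by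
    rw [hrp]
    exact le_powSup _ _ _
  have hPJ : (rp p k K).toSubfield ⊔ rootSubfield p κ J = ⊤ := by
    rw [hrp]
    exact powSup_top_sup_rootSubfield_eq_top hJ J
  obtain ⟨t, hdi, hle, hge⟩ := exists_di_eq (rp p k K) hfin fun n => (hd n).2
  have hU := boundedU_succ_iff hfin
  have hnot : ¬ BoundedU p k K (t + 1) := by
    rw [hU]
    exact not_hasLargeExponents_succ hκP hfin hrp.ge hle
  refine ⟨t, hdi, ?_⟩
  tfae_have 1 → 2 := by
    rintro ⟨L, hLf, hmod⟩ s hs hst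
    obtain ⟨s, rfl⟩ := Nat.exists_eq_add_of_le' hs
    rw [hU]
    exact (hasLargeExponents_of_linDisjointOverInf hp h1 hκP hfin hge
      (fun _ ⟨x, hx⟩ => hx ▸ L.algebraMap_mem x)
      ((finiteDimensional_iff_relfinrank_pos L).1 hLf) ((isModularOver_iff L).1 hmod)).mono hst
  tfae_have 2 → 1 := by
    intro h
    have hlarge : HasLargeExponents p κ t := by
      -- For t = 0 condition 2 is empty, and the needed bound only says that step degrees are
      -- positive.
      cases t with
      | zero =>
        refine ⟨0, fun j r _ => ?_⟩
        rw [pow_zero]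
        exact powDegree_pos (le_rootSubfield κ j) (hfin j) r
      | succ t => exact (hU t).1 (h (t + 1) (by omega) le_rfl)
    obtain ⟨j, hj⟩ := exists_linDisjointOverInf hp hκP hfin hPJ hle hlarge
    exact ⟨level p k K j, (finiteDimensional_iff_relfinrank_pos _).2 (hfin j),
      (isModularOver_iff _).2 hj⟩
  tfae_have 2 → 3 := by
    intro h
    -- This makes the set nonempty, so `Ilqm` is a genuine minimum and not the default value 0.
    have hmem : t + 1 ∈ {i : ℕ | 1 ≤ i ∧ ¬ BoundedU p k K i} := ⟨by omega, hnot⟩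
    refine le_antisymm (Nat.sInf_le hmem) ?_
    by_contra! hlt
    obtain ⟨hs, hs'⟩ := Nat.sInf_mem ⟨_, hmem⟩
    exact hs' (h _ hs (Nat.lt_succ_iff.1 hlt))
  tfae_have 3 → 2 := by
    intro h s hs hst
    by_contra hb
    have : Ilqm p k K ≤ s := Nat.sInf_le ⟨hs, hb⟩
    omega
  tfae_finish
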